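/- **Theorem 7.9.** Let $p$ be a prime, $q=p^a$, and $0\le m\le n$. Let ${\bf a}_1,\dots,{\bf a}_N\in\mathbb{Z}^n$ have non-negative $j$-th coordinates for all $m<j\le n$, and suppose that for each such $j$ some ${\bf a}_i$ has nonzero $j$-th coordinate. Let ${\bf e}=(e_1,\dots,e_m,0,\dots,0)\in\mathbb{Z}^n$. For $\lambda\in\mathbb{F}_q^N$ put $f_\lambda=\sum_{j=1}^N\lambda_jx^{{\bf a}_j}$ and $$S_{\rm aff}(f_\lambda,{\bf e})=\sum_{x\in(\mathbb{F}_q^\times)^m\times\mathbb{F}_q^{n-m}}\ \prod_{i=1}^m\omega(x_i)^{-e_i}\,\Psi(f_\lambda(x))\in\mathbb{Q}_p(\zeta_p,\zeta_{q-1}).$$ Here $\omega$ is the Teichmüller character (with $\omega(0)=0$), $\pi^{p-1}=-p$, $\zeta_p$ is the $p$-th root of unity with $\zeta_p\equiv1+\pi\pmod{\pi^2}$, and $\Psi(x)=\zeta_p^{{\rm Tr}_{\mathbb{F}_q/\mathbb{F}_p}(x)}$. *Weights.* For $\beta\in\mathbb{Z}^n$ let $U^+(\beta)=\{u\in\mathbb{N}^N:\sum_iu_i{\bf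 a}_i=\beta\}$, let $w(\beta)$ be the minimum of $\sum_iu_i$ over $u\in U^+(\beta)$, and let $U^+_{\min}(\beta)$ be the set of $u\in U^+(\beta)$ that attain it. Call $\beta$ good if $u_i\le p-1$ for all $i$ and all $u\in U^+_{\min}(\beta)$, and then put $$F_\beta(\lambda)=\sum_{u\in U^+_{\min}(\beta)}\frac{\lambda_1^{u_1}\cdots\lambda_N^{u_N}}{u_1!\cdots u_N!}\in\mathbb{F}_p[\lambda_1,\dots,\lambda_N].$$ For $u\in\{0,\dots,q-1\}^N$ let $w_p(u)$ be the sum of the base-$p$ digits of all $u_i$. For $M\subseteq\mathbb{Z}^n$ let $U_M=\{u\in\{0,\dots,q-1\}^N:\sum_iu_i{\bf a}_i\in M\}$ and $w_p(M)=\min_{u\in U_M}w_p(u)$. Let $\Gamma_M$ be the set of sequences $(\gamma_0,\dots,\gamma_{a-1})$ of good elements of $\mathbb{Z}^n$ with $\sum_kp^k\gamma_k\in M$ and $\sum_kw(\gamma_k)=w_p(M)$. Minima over the empty set are $+\infty$. *Strata.* Let $M={\bf e}+(q-1)\mathbb{Z}^n$, assume $U_M\ne\emptyset$, and for $0\le l\le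 n-m$ let $M_l$ be the set of points of $M$ with exactly $l$ nonzero coordinates among those with index $>m$. Put $$H(\lambda)={\sum_l}'(-1)^{m+l+a(n-m-l)}\sum_{(\gamma_0,\dots,\gamma_{a-1})\in\Gamma_{M_l}}F_{\gamma_0}(\lambda)F_{\gamma_1}(\lambda^p)\cdots F_{\gamma_{a-1}}(\lambda^{p^{a-1}}),$$ where $\sum'_l$ runs over those $l$ with $w_p(M_l)+a(n-m-l)(p-1)=w_p(M_{n-m})$. *Conclusion.* The number $C=w_p(M_{n-m})$ is finite, and $H$ is the Hasse invariant of $S_{\rm aff}(f_\lambda,{\bf e})$, with exponent $C$. That is, $H\neq0$ as a polynomial, and $H$ is the reduction mod $p$ of a polynomial $\hat H\in(\mathbb{Q}\cap\mathbb{Z}_p)[\Lambda_1,\dots,\Lambda_N]$ of degree at most $q-1$ in each variable such that, for all $\lambda\in\mathbb{F}_q^N$, $$S_{\rm aff}(f_\lambda,{\bf e})\equiv\hat H(\omega(\lambda_1),\dots,\omega(\lambda_N))\,\pi^C\pmod{\pi^{C+1}}.$$ Moreover, for each $\lambda\in\mathbb{F}_q^N$: if $H(\lambda)\ne0$, then ${\rm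 ord}_p\,S_{\rm aff}(f_\lambda,{\bf e})=w_p(M_{n-m})/(p-1)$; and if $H(\lambda)=0$, then ${\rm ord}_p\,S_{\rm aff}(f_\lambda,{\bf e})>w_p(M_{n-m})/(p-1)$. Here ${\rm ord}_p\,p=1$ and ${\rm ord}_p\,0=\infty$. -/

import Mathlib

namespace HasseAffine

open Finset MvPolynomial

/-! ### Lattice points, weights, good points, and the mod `p` polynomials `F_γ` -/

section Lattice

variable {N n : ℕ}

/-- The lattice point `∑ i, u i • a_i`, where the `a_i` are the members of `A`. -/
def latticeSum (A : Fin N → Fin n → ℤ) (u : Fin N → ℕ) : Fin n → ℤ :=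
  ∑ i, (u i : ℤ) • A i

/-- `U⁺(β)`: the vectors of natural numbers `u` with `∑ i, u i • a_i = β`. -/
def Uplus (A : Fin N → Fin n → ℤ) (β : Fin n → ℤ) : Set (Fin N → ℕ) :=
  {u | latticeSum A u = β}

/-- The weight `w(β) = min {∑ i, u i | u ∈ U⁺(β)}`, which is `⊤` if `U⁺(β)` is empty. -/
noncomputable def weight (A : Fin N → Fin n → ℤ) (β : Fin n → ℤ) : ℕ∞ :=
  ⨅ u ∈ Uplus A β, ((∑ i, u i : ℕ) : ℕ∞)

/-- `U⁺_min(β)`: the minimal elements of `U⁺(β)`. -/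
def UplusMin (A : Fin N → Fin n → ℤ) (β : Fin n → ℤ) : Set (Fin N → ℕ) :=
  {u | u ∈ Uplus A β ∧ ((∑ i, u i : ℕ) : ℕ∞) = weight A β}

/-- `β` is good if all coordinates of all minimal elements of `U⁺(β)` are at most `p - 1`. -/
def IsGood (p : ℕ) (A : Fin N → Fin n → ℤ) (β : Fin n → ℤ) : Prop :=
  ∀ u ∈ UplusMin A β, ∀ i, u i ≤ p - 1

/-- The polynomial `F_β = ∑ λ^u / (u_1! ⋯ u_N!)` over `𝔽_p`, summed over the set `U⁺_min(β)`,
which is finite by `uplusMin_finite`. It is used for good `β`, for which the factorials are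
invertible in `𝔽_p`. -/
noncomputable def Fpoly (p : ℕ) [Fact p.Prime] (A : Fin N → Fin n → ℤ) (β : Fin n → ℤ) :
    MvPolynomial (Fin N) (ZMod p) :=
  ∑ᶠ u ∈ UplusMin A β, C (∏ i, ((Nat.factorial (u i) : ZMod p))⁻¹) * ∏ i, X i ^ u i

/-- The `p`-weight `w_p(u)`: the sum of the `a` lowest base `p` digits of all coordinates of `u`
(that is, of all their digits if the coordinates are at most `p ^ a - 1`). -/
def pWeight (p a : ℕ) (u : Fin N → ℕ) : ℕ :=
  ∑ i, ∑ k ∈ range a, u i / p ^ k % p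

/-- `U_M`: the vectors `u` with `0 ≤ u_i ≤ p ^ a - 1` and `∑ i, u i • a_i ∈ M`. -/
def UM (p a : ℕ) (A : Fin N → Fin n → ℤ) (M : Set (Fin n → ℤ)) : Set (Fin N → ℕ) :=
  {u | (∀ i, u i ≤ p ^ a - 1) ∧ latticeSum A u ∈ M}

/-- The `p`-weight `w_p(M) = min {w_p(u) | u ∈ U_M}`, which is `⊤` if `U_M` is empty. -/
noncomputable def pWeightSet (p a : ℕ) (A : Fin N → Fin n → ℤ) (M : Set (Fin n → ℤ)) : ℕ∞ :=
  ⨅ u ∈ UM p a A M, (pWeight p a u : ℕ∞)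

/-- `Γ_M`: the sequences `(γ_0, …, γ_{a-1})` of good lattice points such that
`∑ k, p ^ k • γ_k ∈ M` and `w_p(M) = ∑ k, w(γ_k)`. When `w_p(M)` is finite, the last condition
forces every `γ_k` to be a combination of members of `A` with natural coefficients, and `Γ_M` is
finite by `gammaSet_finite`. -/
def GammaSet (p a : ℕ) (A : Fin N → Fin n → ℤ) (M : Set (Fin n → ℤ)) :
    Set (Fin a → Fin n → ℤ) :=
  {γ | (∀ k, IsGood p A (γ k)) ∧ (∑ k : Fin a, (p : ℤ) ^ (k : ℕ) • γ k) ∈ M ∧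
    pWeightSet p a A M = ∑ k, weight A (γ k)}

/-- `M = e + (q - 1) ℤⁿ`, where `q = p ^ a`. -/
def Mset (p a : ℕ) (e : Fin n → ℤ) : Set (Fin n → ℤ) :=
  {b | ∀ j, ((p : ℤ) ^ a - 1) ∣ b j - e j}

/-- `M_l`: the points of `M` with exactly `l` nonzero coordinates among the affine coordinates,
which are the last `n - m` ones. -/
def Mstratum (p a m : ℕ) (e : Fin n → ℤ) (l : ℕ) : Set (Fin n → ℤ) :=
  {b | b ∈ Mset p a e ∧ #{j : Fin n | m ≤ (j : ℕ) ∧ b j ≠ 0} = l}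

open Classical in
/-- The set of those `l ∈ {0, …, n - m}` for which
`w_p(M_l) + a (n - m - l) (p - 1) = w_p(M_{n-m})`. -/
noncomputable def extremalStrata (p a m : ℕ) (A : Fin N → Fin n → ℤ) (e : Fin n → ℤ) :
    Finset ℕ :=
  {l ∈ range (n - m + 1) |
    pWeightSet p a A (Mstratum p a m e l) + ((a * (n - m - l) * (p - 1) : ℕ) : ℕ∞) =
      pWeightSet p a A (Mstratum p a m e (n - m))}

/-- The polynomial
`H = ∑' l, (-1) ^ (m + l + a (n - m - l)) *`
`∑ γ ∈ Γ_{M_l}, F_{γ_0}(λ) F_{γ_1}(λ ^ p) ⋯ F_{γ_{a-1}}(λ ^ (p ^ (a - 1)))`,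
where `l` runs over the strata for which equality holds. -/
noncomputable def hassePoly (p a m : ℕ) [Fact p.Prime] (A : Fin N → Fin n → ℤ)
    (e : Fin n → ℤ) : MvPolynomial (Fin N) (ZMod p) :=
  ∑ l ∈ extremalStrata p a m A e, (-1) ^ (m + l + a * (n - m - l)) *
    ∑ᶠ γ ∈ GammaSet p a A (Mstratum p a m e l),
      ∏ k : Fin a, expand (p ^ (k : ℕ)) (Fpoly p A (γ k))

theorem finite_sum_le (W : ℕ) :
    {u : Fin N → ℕ | ∑ i, u i ≤ W}.Finite := by
  refine (Set.Finite.pi' (t := fun _ : Fin N => Set.Iic W) fun _ => Set.finite_Iic W).subset ?_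
  intro u hu i
  exact (Finset.single_le_sum (f := u) (fun _ _ => Nat.zero_le _) (mem_univ i)).trans hu

theorem exists_of_weight_le (A : Fin N → Fin n → ℤ) (β : Fin n → ℤ) (W : ℕ)
    (h : weight A β ≤ W) : ∃ u ∈ Uplus A β, ∑ i, u i ≤ W := by
  by_contra! hc
  have h2 : ((W + 1 : ℕ) : ℕ∞) ≤ weight A β := by
    refine le_iInf₂ fun u hu => ?_
    exact_mod_cast hc u hu
  have h3 := h2.trans h
  have h4 : W + 1 ≤ W := by exact_mod_cast h3
  omega

theorem uplusMin_finite (A : Fin N → Fin n → ℤ) (β : Fin n → ℤ) : (UplusMin A β).Finite := by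
  by_cases hw : weight A β = ⊤
  · convert Set.finite_empty
    ext u
    simp only [UplusMin, hw, Set.mem_ofPred_eq, Set.mem_empty_iff_false, iff_false, not_and]
    exact fun _ h => ENat.natCast_ne_top _ h
  · obtain ⟨W, hW⟩ := ENat.ne_top_iff_exists.mp hw
    refine (finite_sum_le W).subset fun u hu => ?_
    have h := hu.2
    rw [← hW] at h
    exact (by exact_mod_cast h : ∑ i, u i = W).le

theorem gammaSet_finite (p a : ℕ) (A : Fin N → Fin n → ℤ) (M : Set (Fin n → ℤ))
    (h : pWeightSet p a A M ≠ ⊤) : (GammaSet p a A M).Finite := by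
  obtain ⟨W, hW⟩ := ENat.ne_top_iff_exists.mp h
  have hf : (latticeSum A '' {u : Fin N → ℕ | ∑ i, u i ≤ W}).Finite :=
    (finite_sum_le W).image _
  refine (Set.Finite.pi' (t := fun _ : Fin a => latticeSum A '' _) fun _ => hf).subset ?_
  intro γ hγ k
  have h1 : weight A (γ k) ≤ W := by
    rw [hW, hγ.2.2]
    exact Finset.single_le_sum (f := fun k => weight A (γ k)) (fun _ _ => zero_le)
      (mem_univ k)
  obtain ⟨u, hu, hu2⟩ := exists_of_weight_le A (γ k) W h1
  exact ⟨u, hu2, hu⟩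

end Lattice

/-! ### Exponential sums and their Hasse invariants -/

section Sums

variable {K : Type*} [NormedField K]
variable {F : Type*} [Field F]

/-- `ω : F → K` (with `ω 0 = 0`) is a Teichmüller character: it is multiplicative, and its
reduction modulo the maximal ideal `{z | ‖z‖ < 1}` is additive. Equivalently, the reduction is an
embedding of `F` in the residue field of `K`, and `ω` is the multiplicative lift of it. -/
def IsTeichmuller (ω : F →*₀ K) : Prop :=
  ∀ x y, ‖ω (x + y) - (ω x + ω y)‖ < 1

/-- The congruence `x ≡ y (mod π ^ c)`: the difference lies in `π ^ c 𝒪`, where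
`𝒪 = {z | ‖z‖ ≤ 1}` is the ring of integers. -/
def CongrMod (π : K) (c : ℕ) (x y : K) : Prop :=
  ∃ z : K, ‖z‖ ≤ 1 ∧ x - y = π ^ c * z

open Classical in
/-- The valuation `ord_p`, normalized by `ord_p p = 1`; `ord_p 0 = ∞`. -/
noncomputable def ordp (p : ℕ) (x : K) : EReal :=
  if x = 0 then ⊤ else ((-Real.logb p ‖x‖ : ℝ) : EReal)

/-- The additive character `Ψ = ψ ∘ Tr` of `F`, where `Tr` is the trace from `F` to `𝔽_p`
and `ψ` is the additive character of `𝔽_p` with `ψ 1 = ζ`, for a `p`-th root of unity `ζ`. -/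
noncomputable def Psi (p : ℕ) [Algebra (ZMod p) F] (ζ : K) (x : F) : K :=
  ζ ^ (Algebra.trace (ZMod p) F x).val

/-- The value `f_λ(x) = ∑ j, λ_j x^{a_j}` (with `0 ^ 0 = 1`, as usual). -/
def fEval {N n : ℕ} (A : Fin N → Fin n → ℤ) (lam : Fin N → F) (x : Fin n → F) : F :=
  ∑ j, lam j * ∏ i, x i ^ A j i

open Classical in
/-- The exponential sum `S_aff(f_λ, e) = ∑ x, (∏_{i ≤ m} ω(x_i) ^ (-e_i)) Ψ(f_λ(x))` over
`x ∈ (F^×)^m × F^{n-m}`: the first `m` variables are toric, the others are affine. -/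
noncomputable def Saff [Fintype F] (p : ℕ) [Algebra (ZMod p) F] {N n : ℕ} (m : ℕ) (ζ : K)
    (ω : F →*₀ K) (A : Fin N → Fin n → ℤ) (e : Fin n → ℤ) (lam : Fin N → F) : K :=
  ∑ x : Fin n → F with ∀ i : Fin n, i.val < m → x i ≠ 0,
    (∏ i : Fin n with i.val < m, ω (x i) ^ (-e i)) * Psi p ζ (fEval A lam x)

/-- `H` is the Hasse invariant of the family `S` (a function of `λ ∈ F^N`, where `F` has `p ^ a`
elements), and `c` is the corresponding exponent: there is a polynomial `Hhat` with coefficients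
in `ℚ ∩ ℤ_p`, of degree at most `p ^ a - 1` in each variable, with nonzero reduction `H` mod `p`,
such that `S(λ) ≡ Hhat(ω(λ)) π ^ c (mod π ^ (c + 1))` for all `λ`. These conditions determine `c`
and `H`. -/
def IsHasseInvariant (p a : ℕ) [Fact p.Prime] [NormedAlgebra ℚ_[p] K] {N : ℕ} (π : K)
    (ω : F →*₀ K) (S : (Fin N → F) → K) (c : ℕ) (H : MvPolynomial (Fin N) (ZMod p)) : Prop :=
  ∃ Hhat : MvPolynomial (Fin N) ℤ_[p],
    (∀ s, ∃ r : ℚ, ((Hhat.coeff s : ℤ_[p]) : ℚ_[p]) = (r : ℚ_[p])) ∧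
    (∀ j, Hhat.degreeOf j ≤ p ^ a - 1) ∧
    MvPolynomial.map PadicInt.toZMod Hhat = H ∧
    H ≠ 0 ∧
    ∀ lam : Fin N → F, CongrMod π (c + 1) (S lam)
      (MvPolynomial.eval₂ ((algebraMap ℚ_[p] K).comp PadicInt.Coe.ringHom)
        (fun j => ω (lam j)) Hhat * π ^ c)

end Sums

end HasseAffine

/-! On `F` the additive character is a polynomial in `ω`: Ψ(t) = ∑ c_j ω(t)^j over 0 ≤ j < q.
Stickelberger's congruence gives the leading term of each coefficient: c_j is π^s, with s the sum of
the base-p digits of j, times an integral element whose residue is the inverse of the product of the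
factorials of these digits (`lead_gaussSum`, `lead_psiCoeff`).

Insert this expansion for every monomial of f_λ and sum over x. Orthogonality of the powers of `ω`
kills all exponent vectors u except those with ∑ u_i a_i ∈ M. For these the sum over x is
(q-1)^(m+r) q^(n-m-r), where r counts the nonzero affine coordinates of ∑ u_i a_i (`saff_eq_sum`).
Since q = p^a and p = -π^(p-1), the term of u is π to the power w_p(u) + a(n-m-r)(p-1) times an
integral element with residue ±λ^u divided by the factorials of all digits of u.

The least of these exponents is C = w_p(M_{n-m}): a vector in a smaller stratum moves to the open
one when suitable zero coordinates are replaced by q-1, which costs at most a(p-1) for each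
vanishing affine coordinate (`exists_mem_open_stratum`). Hence S is π^C times an integral element
whose residue is the sum of the leading coefficients of exponent C. As a polynomial in λ this sum is
nonzero, because distinct u give distinct monomials with nonzero coefficients.

It remains to see that this polynomial is H. If u has least p-weight in its stratum, its digit
vectors are minimal representations of good points: otherwise exchanging one digit vector and
carrying cyclically modulo q-1 would give a smaller weight (`minimal_digitVec`). Conversely, minimal
representations of good points have entries below p, so they are the digit vectors of some u. Thus
the minimal u correspond to a sequence γ in Γ together with a minimal representation of each γ_k,
and the sum over them splits into the products of the F_{γ_k}(λ^(p^k)) (`finsum_gammaSet_eq`). -/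

namespace HasseAffine

open Finset MvPolynomial

/-! ### Residues and leading terms modulo `π` -/

section Reduction

variable {K : Type*} [NormedField K] {F : Type*} [Field F]

/-- `z` reduces to `t ∈ F` modulo `π`, where `F` is identified with a subfield of `𝒪 / π` by `ω`. -/
def Red (ω : F →*₀ K) (π z : K) (t : F) : Prop := ‖z - ω t‖ ≤ ‖π‖

/-- `x` is `π ^ w` times an integral element that reduces to `t`. -/
def Lead (ω : F →*₀ K) (π : K) (w : ℕ) (x : K) (t : F) : Prop :=
  ∃ z, x = π ^ w * z ∧ Red ω π z t

/-- The properties of `ω` and `π` that make `Red` compatible with the ring operations. -/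
structure IsResidueLift (ω : F →*₀ K) (π : K) : Prop where
  lt_one : ‖π‖ < 1
  ne_zero : π ≠ 0
  norm_eq_one : ∀ t, t ≠ 0 → ‖ω t‖ = 1
  add : ∀ x y, ‖ω (x + y) - (ω x + ω y)‖ ≤ ‖π‖

theorem norm_map_eq_one [Finite F] (ω : F →*₀ K) (t : F) (ht : t ≠ 0) : ‖ω t‖ = 1 := by
  have := Fintype.ofFinite F
  have h := FiniteField.pow_card_sub_one_eq_one t ht
  have h2 : ‖ω t‖ ^ (Fintype.card F - 1) = 1 := by rw [← norm_pow, ← map_pow, h]; simp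
  exact (pow_eq_one_iff_of_nonneg (norm_nonneg _)
    (Nat.sub_ne_zero_of_lt Fintype.one_lt_card)).mp h2

variable {ω : F →*₀ K} {π : K}

theorem IsResidueLift.norm_le_one (h : IsResidueLift ω π) (t : F) : ‖ω t‖ ≤ 1 := by
  by_cases ht : t = 0
  · simp [ht]
  · exact (h.norm_eq_one t ht).le

theorem Red.map (ω : F →*₀ K) (π : K) (t : F) : Red ω π (ω t) t := by
  simp [Red]

theorem Red.zero (ω : F →*₀ K) (π : K) : Red ω π 0 0 := by
  simpa using Red.map ω π 0

theorem Red.one (ω : F →*₀ K) (π : K) : Red ω π 1 1 := by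
  simpa using Red.map ω π 1

variable [IsUltrametricDist K]

theorem norm_add_le_of_le {x y : K} {r : ℝ} (hx : ‖x‖ ≤ r) (hy : ‖y‖ ≤ r) : ‖x + y‖ ≤ r :=
  (IsUltrametricDist.norm_add_le_max x y).trans (max_le hx hy)

theorem norm_sub_le_of_le {x y : K} {r : ℝ} (hx : ‖x‖ ≤ r) (hy : ‖y‖ ≤ r) : ‖x - y‖ ≤ r :=
  sub_eq_add_neg x y ▸ norm_add_le_of_le hx ((norm_neg y).le.trans hy)

namespace Red

theorem norm_le_one (h : IsResidueLift ω π) {z : K} {t : F} (hz : Red ω π z t) : ‖z‖ ≤ 1 := by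
  have := norm_add_le_of_le (hz.trans h.lt_one.le) (h.norm_le_one t)
  simpa using this

theorem norm_sub_le {z z' : K} {t : F} (hz : Red ω π z t) (hz' : Red ω π z' t) :
    ‖z - z'‖ ≤ ‖π‖ := by
  have := norm_sub_le_of_le hz hz'
  simpa using this

theorem add (h : IsResidueLift ω π) {z z' : K} {t t' : F} (hz : Red ω π z t)
    (hz' : Red ω π z' t') : Red ω π (z + z') (t + t') := by
  have := norm_sub_le_of_le (norm_add_le_of_le hz hz') (h.add t t')
  rw [Red]
  convert this using 2
  ring

theorem mul (h : IsResidueLift ω π) {z z' : K} {t t' : F} (hz : Red ω π z t)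
    (hz' : Red ω π z' t') : Red ω π (z * z') (t * t') := by
  have h1 : ‖(z - ω t) * z'‖ ≤ ‖π‖ := by
    rw [norm_mul]
    exact (mul_le_of_le_one_right (norm_nonneg _) (hz'.norm_le_one h)).trans hz
  have h2 : ‖ω t * (z' - ω t')‖ ≤ ‖π‖ := by
    rw [norm_mul]
    exact (mul_le_of_le_one_left (norm_nonneg _) (h.norm_le_one t)).trans hz'
  have := norm_add_le_of_le h1 h2
  rw [Red, map_mul]
  convert this using 2
  ring

omit [IsUltrametricDist K] in
theorem of_norm_le {z : K} (hz : ‖z‖ ≤ ‖π‖) : Red ω π z 0 := by simpa [Red] using hz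

/-- Two residues t ≠ t' of one element would force the norm of ω(t - t') down to ‖π‖, but it is 1.
-/
theorem eq (h : IsResidueLift ω π) {z : K} {t t' : F} (hz : Red ω π z t)
    (hz' : Red ω π z t') : t = t' := by
  by_contra hne
  have h1 : ‖ω t - ω t'‖ ≤ ‖π‖ := by
    have := norm_sub_le_of_le hz' hz
    simpa using this
  have h2 := h.add t' (t - t')
  have h3 := norm_sub_le_of_le h1 h2
  have h4 : ω t - ω t' - (ω (t' + (t - t')) - (ω t' + ω (t - t'))) = ω (t - t') := by
    rw [add_sub_cancel]; ring
  rw [h4, h.norm_eq_one _ (sub_ne_zero.mpr hne)] at h3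
  exact absurd h.lt_one (not_lt.mpr h3)

theorem norm_eq_one (h : IsResidueLift ω π) {z : K} {t : F} (hz : Red ω π z t) (ht : t ≠ 0) :
    ‖z‖ = 1 := by
  refine le_antisymm (hz.norm_le_one h) ?_
  by_contra! hlt
  have h1 : ‖z - ω t‖ = 1 := by
    rw [← h.norm_eq_one t ht, ← norm_neg (ω t), sub_eq_add_neg]
    refine (IsUltrametricDist.norm_add_eq_max_of_norm_ne_norm ?_).trans (max_eq_right ?_)
    · rw [norm_neg, h.norm_eq_one t ht]; exact hlt.ne
    · rw [norm_neg, h.norm_eq_one t ht]; exact hlt.le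
  exact absurd (h1 ▸ hz : (1 : ℝ) ≤ ‖π‖) (not_le.mpr h.lt_one)

theorem inv (h : IsResidueLift ω π) {z : K} {t : F} (hz : Red ω π z t) (ht : t ≠ 0) :
    Red ω π z⁻¹ t⁻¹ := by
  have h1 := hz.norm_eq_one h ht
  have hz0 : z ≠ 0 := by rintro rfl; simp at h1
  have ht0 : ω t ≠ 0 := by simpa using ht
  have : z⁻¹ - ω t⁻¹ = -(z⁻¹ * (ω t)⁻¹ * (z - ω t)) := by
    rw [map_inv₀]; field_simp; ring
  rw [Red, this, norm_neg, norm_mul, norm_mul, norm_inv, norm_inv, h1, h.norm_eq_one t ht,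
    inv_one, one_mul, one_mul]
  exact hz

theorem neg (h : IsResidueLift ω π) {z : K} {t : F} (hz : Red ω π z t) : Red ω π (-z) (-t) := by
  -- Approximate additivity at -1 and 1 gives the residue of -1 without separating the case p = 2.
  have h2 := h.add (-1) 1
  have hm : Red ω π (-1 : K) (-1 : F) := by
    simp only [neg_add_cancel, map_zero, map_one, zero_sub, norm_neg] at h2
    rw [Red, ← norm_neg]
    convert h2 using 2
    ring
  simpa using hm.mul h hz

theorem sub (h : IsResidueLift ω π) {z z' : K} {t t' : F} (hz : Red ω π z t)
    (hz' : Red ω π z' t') : Red ω π (z - z') (t - t') := by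
  rw [sub_eq_add_neg, sub_eq_add_neg]
  exact hz.add h (hz'.neg h)

theorem pow (h : IsResidueLift ω π) {z : K} {t : F} (hz : Red ω π z t) (k : ℕ) :
    Red ω π (z ^ k) (t ^ k) := by
  induction k with
  | zero => simpa using Red.one ω π
  | succ k ih => rw [pow_succ, pow_succ]; exact ih.mul h hz

theorem natCast (h : IsResidueLift ω π) (k : ℕ) : Red ω π (k : K) (k : F) := by
  induction k with
  | zero => simpa using Red.zero ω π
  | succ k ih => push_cast; exact ih.add h (Red.one ω π)

theorem sum (h : IsResidueLift ω π) {ι : Type*} (s : Finset ι) {z : ι → K} {t : ι → F}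
    (hz : ∀ i ∈ s, Red ω π (z i) (t i)) : Red ω π (∑ i ∈ s, z i) (∑ i ∈ s, t i) := by
  classical
  induction s using Finset.induction_on with
  | empty => simpa using Red.zero ω π
  | insert i s hi ih =>
    rw [sum_insert hi, sum_insert hi]
    exact (hz i (mem_insert_self _ _)).add h (ih fun j hj => hz j (mem_insert_of_mem hj))

theorem prod (h : IsResidueLift ω π) {ι : Type*} (s : Finset ι) {z : ι → K} {t : ι → F}
    (hz : ∀ i ∈ s, Red ω π (z i) (t i)) : Red ω π (∏ i ∈ s, z i) (∏ i ∈ s, t i) := by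
  classical
  induction s using Finset.induction_on with
  | empty => simpa using Red.one ω π
  | insert i s hi ih =>
    rw [prod_insert hi, prod_insert hi]
    exact (hz i (mem_insert_self _ _)).mul h (ih fun j hj => hz j (mem_insert_of_mem hj))

omit [IsUltrametricDist K] in
theorem lead {z : K} {t : F} (hz : Red ω π z t) : Lead ω π 0 z t := ⟨z, by simp, hz⟩

end Red

namespace Lead

theorem mul (h : IsResidueLift ω π) {v w : ℕ} {x y : K} {s t : F} (hx : Lead ω π v x s)
    (hy : Lead ω π w y t) : Lead ω π (v + w) (x * y) (s * t) := by
  obtain ⟨z, rfl, hz⟩ := hx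
  obtain ⟨z', rfl, hz'⟩ := hy
  exact ⟨z * z', by ring, hz.mul h hz'⟩

theorem prod (h : IsResidueLift ω π) {ι : Type*} (s : Finset ι) {w : ι → ℕ} {x : ι → K}
    {t : ι → F} (hx : ∀ i ∈ s, Lead ω π (w i) (x i) (t i)) :
    Lead ω π (∑ i ∈ s, w i) (∏ i ∈ s, x i) (∏ i ∈ s, t i) := by
  choose! z hz hz' using hx
  refine ⟨∏ i ∈ s, z i, ?_, Red.prod h s hz'⟩
  rw [prod_congr rfl hz, prod_mul_distrib, prod_pow_eq_pow_sum]

theorem sum (h : IsResidueLift ω π) {ι : Type*} (s : Finset ι) {w : ℕ} {x : ι → K}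
    {t : ι → F} (hx : ∀ i ∈ s, Lead ω π w (x i) (t i)) :
    Lead ω π w (∑ i ∈ s, x i) (∑ i ∈ s, t i) := by
  choose! z hz hz' using hx
  refine ⟨∑ i ∈ s, z i, ?_, Red.sum h s hz'⟩
  rw [sum_congr rfl hz, mul_sum]

/-- Lets terms of different orders be added at one common exponent, where those of higher order
contribute 0. -/
theorem zero_of_lt (h : IsResidueLift ω π) {v w : ℕ} {x : K} {t : F} (hx : Lead ω π w x t)
    (hvw : v < w) : Lead ω π v x 0 := by
  obtain ⟨z, rfl, hz⟩ := hx
  obtain ⟨k, rfl⟩ := Nat.exists_eq_add_of_lt hvw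
  refine ⟨π ^ (k + 1) * z, by ring, Red.of_norm_le ?_⟩
  rw [norm_mul, norm_pow, pow_succ]
  have h1 : ‖π‖ ^ k ≤ 1 := pow_le_one₀ (norm_nonneg _) h.lt_one.le
  calc _ ≤ ‖π‖ ^ k * ‖π‖ * 1 := by
        gcongr; exact hz.norm_le_one h
    _ ≤ _ := by rw [mul_one]; exact mul_le_of_le_one_left (norm_nonneg _) h1

theorem norm_eq (h : IsResidueLift ω π) {w : ℕ} {x : K} {t : F} (hx : Lead ω π w x t)
    (ht : t ≠ 0) : ‖x‖ = ‖π‖ ^ w := by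
  obtain ⟨z, rfl, hz⟩ := hx
  rw [norm_mul, hz.norm_eq_one h ht, norm_pow, mul_one]

omit [IsUltrametricDist K] in
theorem norm_lt (h : IsResidueLift ω π) {w : ℕ} {x : K} (hx : Lead ω π w x (0 : F)) :
    ‖x‖ < ‖π‖ ^ w := by
  obtain ⟨z, rfl, hz⟩ := hx
  rw [norm_mul, norm_pow]
  have hz' : ‖z‖ ≤ ‖π‖ := by simpa [Red] using hz
  exact mul_lt_of_lt_one_right (pow_pos (norm_pos_iff.mpr h.ne_zero) _)
    (hz'.trans_lt h.lt_one)

end Lead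

/-- The mixed terms of the binomial expansion are all divisible by p·x·y; the factor y is kept for
the bootstrap that follows. -/
theorem norm_add_pow_sub_le (p : ℕ) [Fact p.Prime] {x y : K} (hx : ‖x‖ ≤ 1) (hy : ‖y‖ ≤ 1)
    (k : ℕ) : ‖(x + y) ^ p ^ k - (x ^ p ^ k + y ^ p ^ k)‖ ≤ ‖(p : K)‖ * ‖y‖ := by
  rw [add_pow_prime_pow_eq (Fact.out : p.Prime), add_sub_cancel_left, norm_mul, norm_mul, norm_mul,
    mul_assoc, mul_assoc]
  refine mul_le_mul_of_nonneg_left ?_ (norm_nonneg _)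
  refine (mul_le_of_le_one_left (by positivity) hx).trans
    (mul_le_of_le_one_right (norm_nonneg _) ?_)
  refine IsUltrametricDist.norm_sum_le_of_forall_le_of_nonneg zero_le_one fun i _ => ?_
  rw [norm_mul, norm_mul, norm_pow, norm_pow]
  have h1 := pow_le_one₀ (n := i - 1) (norm_nonneg x) hx
  have h2 := pow_le_one₀ (n := p ^ k - i - 1) (norm_nonneg y) hy
  exact mul_le_one₀ (mul_le_one₀ h1 (by positivity) h2) (norm_nonneg _)
    (IsUltrametricDist.norm_natCast_le_one K _)

/-- The bound < 1 improves itself to ≤ ‖p‖, because values of `ω` are fixed by the q-th power map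
while the additive defect d is contracted by it. No knowledge of the value group of `K` is needed.
-/
theorem IsTeichmuller.norm_add_le [Fintype F] (p a : ℕ) [Fact p.Prime]
    (hF : Fintype.card F = p ^ a) (hω : IsTeichmuller ω) (x y : F) :
    ‖ω (x + y) - (ω x + ω y)‖ ≤ ‖(p : K)‖ := by
  have hle (t : F) : ‖ω t‖ ≤ 1 := by
    by_cases ht : t = 0
    · simp [ht]
    · exact (norm_map_eq_one ω t ht).le
  have hpow (t : F) : ω t ^ p ^ a = ω t := by rw [← map_pow, ← hF, FiniteField.pow_card]
  obtain ⟨d, hd⟩ : ∃ d, d = ω x + ω y - ω (x + y) := ⟨_, rfl⟩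
  have hd1 : ‖d‖ < 1 := by rw [hd, ← norm_neg, neg_sub]; exact hω x y
  have h1 := norm_add_pow_sub_le p (hle x) (hle y) a
  have h2 := norm_add_pow_sub_le p (hle (x + y)) hd1.le a
  rw [show ω (x + y) + d = ω x + ω y by rw [hd]; ring] at h2
  rw [hpow, hpow] at h1
  rw [hpow] at h2
  rw [← norm_neg, neg_sub, ← hd]
  by_contra! hlt
  have hd0 : 0 < ‖d‖ := (norm_nonneg _).trans_lt hlt
  have hp1 : ‖(p : K)‖ ≤ 1 := IsUltrametricDist.norm_natCast_le_one K p
  have h3 : ‖d ^ p ^ a‖ < ‖d‖ := by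
    rw [norm_pow]
    refine pow_lt_self_of_lt_one₀ hd0 hd1 ?_
    rw [← hF]; exact Fintype.one_lt_card
  have h4 : ‖(p : K)‖ * ‖d‖ < ‖d‖ :=
    mul_lt_of_lt_one_left hd0 (hlt.trans hd1)
  have h5 : ‖(p : K)‖ * ‖ω y‖ < ‖d‖ :=
    (mul_le_of_le_one_right (norm_nonneg _) (hle y)).trans_lt hlt
  -- If ‖d‖ > ‖p‖, the three summands, bounded by ‖p‖‖d‖, ‖d‖^q and ‖p‖, are all smaller than d.
  have h6 : d = ((ω x + ω y) ^ p ^ a - (ω (x + y) + d ^ p ^ a)) + d ^ p ^ a -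
      ((ω x + ω y) ^ p ^ a - (ω x + ω y)) := by
    nth_rw 1 [hd]; ring
  have h7 : ‖d‖ ≤ max (max (‖(p : K)‖ * ‖d‖) ‖d ^ p ^ a‖) (‖(p : K)‖ * ‖ω y‖) := by
    nth_rw 1 [h6]
    refine norm_sub_le_of_le (le_max_of_le_left (norm_add_le_of_le ?_ ?_)) ?_
    · exact le_max_of_le_left h2
    · exact le_max_right _ _
    · exact le_max_of_le_right h1
  exact absurd h7 (not_le.mpr (max_lt (max_lt h4 h3) h5))

end Reduction

/-! ### The norm of `π` -/

section Uniformizer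

variable {K : Type*} [NormedField K] (p : ℕ) [Fact p.Prime] [NormedAlgebra ℚ_[p] K]
  {F : Type*} [Field F]

include p in
theorem isUltrametricDist_of_normedAlgebra : IsUltrametricDist K := by
  refine IsUltrametricDist.isUltrametricDist_of_forall_norm_natCast_le_one fun n => ?_
  rw [← map_natCast (algebraMap ℚ_[p] K), norm_algebraMap']
  exact IsUltrametricDist.norm_natCast_le_one ℚ_[p] n

theorem norm_natCast_prime : ‖(p : K)‖ = (p : ℝ)⁻¹ := by
  rw [← map_natCast (algebraMap ℚ_[p] K), norm_algebraMap', Padic.norm_p]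

variable {p} {π : K}

theorem norm_uniformizer_pow (hπ : π ^ (p - 1) = -(p : K)) : ‖π‖ ^ (p - 1) = (p : ℝ)⁻¹ := by
  rw [← norm_pow, hπ, norm_neg, norm_natCast_prime]

theorem norm_uniformizer_lt_one (hπ : π ^ (p - 1) = -(p : K)) : ‖π‖ < 1 := by
  have hp := (Fact.out : p.Prime).one_lt
  by_contra! h
  have h1 := one_le_pow₀ h (n := p - 1)
  rw [norm_uniformizer_pow hπ] at h1
  exact absurd h1 (not_le.mpr (inv_lt_one_of_one_lt₀ (by exact_mod_cast hp)))

theorem norm_natCast_le_uniformizer (hπ : π ^ (p - 1) = -(p : K)) : ‖(p : K)‖ ≤ ‖π‖ := by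
  have hp := (Fact.out : p.Prime).one_lt
  rw [← norm_neg, ← hπ, norm_pow]
  exact pow_le_of_le_one (norm_nonneg _) (norm_uniformizer_lt_one hπ).le (by omega)

theorem uniformizer_ne_zero (hπ : π ^ (p - 1) = -(p : K)) : π ≠ 0 := by
  rintro rfl
  have h := norm_uniformizer_pow hπ
  have hp := (Fact.out : p.Prime).one_lt
  rw [norm_zero, zero_pow (by omega)] at h
  have : (0 : ℝ) < p := by exact_mod_cast hp.pos
  exact (inv_pos.mpr this).ne h

theorem IsTeichmuller.isResidueLift [Fintype F] {a : ℕ} (hF : Fintype.card F = p ^ a)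
    {ω : F →*₀ K} (hω : IsTeichmuller ω) (hπ : π ^ (p - 1) = -(p : K)) : IsResidueLift ω π :=
  have := isUltrametricDist_of_normedAlgebra p (K := K)
  { lt_one := norm_uniformizer_lt_one hπ
    ne_zero := uniformizer_ne_zero hπ
    norm_eq_one := norm_map_eq_one ω
    add := fun x y => (hω.norm_add_le p a hF x y).trans (norm_natCast_le_uniformizer hπ) }

end Uniformizer

/-! ### Base `p` digit sums and products of digit factorials -/

section Digits

/-- The sum of the `a` lowest base `p` digits of `j`. -/
def digitSum (p a j : ℕ) : ℕ := ∑ k ∈ range a, j / p ^ k % p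

/-- The inverse in `F` of the product of the factorials of the `a` lowest base `p` digits
of `j`. -/
def digitCoeff (F : Type*) [Field F] (p a j : ℕ) : F :=
  ∏ k ∈ range a, ((Nat.factorial (j / p ^ k % p) : ℕ) : F)⁻¹

variable {F : Type*} [Field F] {p a : ℕ}

theorem digitSum_zero : digitSum p a 0 = 0 := by simp [digitSum]

theorem digitCoeff_zero : digitCoeff F p a 0 = 1 := by simp [digitCoeff]

/-- Adding 1 causes no carry here, so only the lowest digit changes. -/
theorem succ_div_pow_of_not_dvd {j : ℕ} (hj : ¬ p ∣ j + 1) (k : ℕ) :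
    (j + 1) / p ^ (k + 1) = j / p ^ (k + 1) := by
  rw [Nat.succ_div, if_neg, add_zero]
  exact fun h => hj ((dvd_pow_self p (Nat.succ_ne_zero k)).trans h)

variable [Fact p.Prime]

/-- Multiplication by p shifts the digits; the bound says that the top digit of j, which would be
shifted out, is 0. -/
theorem digitSum_mul {j : ℕ} (hj : p * j < p ^ a) : digitSum p a (p * j) = digitSum p a j := by
  have hp := (Fact.out : p.Prime).pos
  obtain _ | a := a
  · rfl
  have h1 : j / p ^ a = 0 := by
    rw [Nat.div_eq_zero_iff]; right
    rw [pow_succ'] at hj; exact Nat.lt_of_mul_lt_mul_left hj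
  rw [digitSum, digitSum, sum_range_succ', sum_range_succ, h1]
  simp [pow_succ', Nat.mul_div_mul_left _ _ hp]

theorem digitCoeff_mul {j : ℕ} (hj : p * j < p ^ a) :
    digitCoeff F p a (p * j) = digitCoeff F p a j := by
  have hp := (Fact.out : p.Prime).pos
  obtain _ | a := a
  · rfl
  have h1 : j / p ^ a = 0 := by
    rw [Nat.div_eq_zero_iff]; right
    rw [pow_succ'] at hj; exact Nat.lt_of_mul_lt_mul_left hj
  rw [digitCoeff, digitCoeff, prod_range_succ', prod_range_succ, h1]
  simp [pow_succ', Nat.mul_div_mul_left _ _ hp]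

theorem succ_mod_of_not_dvd {j : ℕ} (hj : ¬ p ∣ j + 1) : (j + 1) % p = j % p + 1 := by
  have hp := (Fact.out : p.Prime).pos
  have h1 := Nat.mod_lt j hp
  rcases Nat.lt_or_ge (j % p + 1) p with h | h
  · rw [Nat.add_mod, Nat.mod_eq_of_lt (a := 1) (by omega), Nat.mod_eq_of_lt h]
  · exact absurd (Nat.dvd_of_mod_eq_zero (by
      rw [← Nat.mod_add_mod, show j % p + 1 = p by omega, Nat.mod_self])) hj

theorem digitSum_succ (ha : a ≠ 0) {j : ℕ} (hj : ¬ p ∣ j + 1) :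
    digitSum p a (j + 1) = digitSum p a j + 1 := by
  obtain ⟨a, rfl⟩ := Nat.exists_eq_succ_of_ne_zero ha
  rw [digitSum, digitSum, sum_range_succ', sum_range_succ' (n := a)]
  simp only [succ_div_pow_of_not_dvd hj, pow_zero, Nat.div_one, succ_mod_of_not_dvd hj]
  omega

theorem digitCoeff_succ [CharP F p] (ha : a ≠ 0) {j : ℕ} (hj : ¬ p ∣ j + 1) :
    digitCoeff F p a (j + 1) = digitCoeff F p a j * ((j + 1 : ℕ) : F)⁻¹ := by
  obtain ⟨a, rfl⟩ := Nat.exists_eq_succ_of_ne_zero ha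
  have h : ((j + 1 : ℕ) : F) = ((j % p + 1 : ℕ) : F) := by
    push_cast
    rw [CharP.cast_eq_mod F p j]
  rw [digitCoeff, digitCoeff, prod_range_succ', prod_range_succ' (n := a), h]
  simp only [succ_div_pow_of_not_dvd hj, pow_zero, Nat.div_one, succ_mod_of_not_dvd hj]
  rw [Nat.factorial_succ, Nat.cast_mul, mul_inv]
  ring

theorem pow_sub_one_div_pow_mod {k : ℕ} (hk : k < a) : (p ^ a - 1) / p ^ k % p = p - 1 := by
  have hp := (Fact.out : p.Prime).pos
  obtain ⟨b, rfl⟩ := Nat.exists_eq_add_of_lt hk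
  -- Separates the digits below position k, the digit p - 1 at k, and the digits above.
  have h1 : p ^ (k + b + 1) - 1 = (p ^ k - 1) + p ^ k * ((p - 1) + p * (p ^ b - 1)) := by
    obtain ⟨x, hx⟩ := Nat.exists_eq_add_of_lt (pow_pos hp k)
    obtain ⟨y, hy⟩ := Nat.exists_eq_add_of_lt (pow_pos hp b)
    obtain ⟨z, hz⟩ := Nat.exists_eq_add_of_lt hp
    rw [pow_succ, pow_add, hx, hy, show p - 1 = z by omega]
    rw [show p = z + 1 by omega]
    simp only [zero_add, Nat.add_sub_cancel]
    rw [Nat.sub_eq_iff_eq_add (Nat.succ_le_of_lt (by positivity))]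
    ring
  have h2 : p ^ k - 1 < p ^ k := Nat.sub_lt (pow_pos hp k) one_pos
  rw [h1, Nat.add_mul_div_left _ _ (pow_pos hp k), Nat.div_eq_of_lt h2, zero_add,
    Nat.add_mul_mod_self_left, Nat.mod_eq_of_lt (by omega)]

theorem digitSum_pow_sub_one : digitSum p a (p ^ a - 1) = a * (p - 1) := by
  rw [digitSum, sum_congr rfl fun k hk => pow_sub_one_div_pow_mod (mem_range.mp hk)]
  simp

theorem digitCoeff_pow_sub_one [CharP F p] : digitCoeff F p a (p ^ a - 1) = (-1) ^ a := by
  have h : ((Nat.factorial (p - 1) : ℕ) : F) = -1 := by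
    have := congrArg (ZMod.castHom (dvd_refl p) F) (ZMod.wilsons_lemma p)
    rwa [map_natCast, map_neg, map_one] at this
  rw [digitCoeff, prod_congr rfl fun k hk => by rw [pow_sub_one_div_pow_mod (mem_range.mp hk), h]]
  simp [inv_neg]

end Digits

/-! ### Power sums in the finite field -/

section FiniteFieldSums

variable {F : Type*} [Field F] [Fintype F]

theorem sum_pow_eq {i : ℕ} (hi : i ≠ 0) :
    ∑ x : F, x ^ i = if Fintype.card F - 1 ∣ i then -1 else 0 := by
  classical
  rw [← FiniteField.sum_pow_units F i, ← sum_sdiff (subset_univ {0}), sum_singleton, zero_pow hi,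
    add_zero]
  symm
  refine sum_bij (fun x _ => (x : F)) (fun x _ => by simp) (fun x _ y _ h => Units.ext h)
    (fun y hy => ⟨Units.mk0 y (by simpa using hy), mem_univ _, rfl⟩) fun x _ => rfl

theorem inv_pow_eq_pow {k : ℕ} (hk : k < Fintype.card F - 1) (hk0 : k ≠ 0) (x : F) :
    x⁻¹ ^ k = x ^ (Fintype.card F - 1 - k) := by
  by_cases hx : x = 0
  · rw [hx, inv_zero, zero_pow hk0, zero_pow (by omega)]
  · have h := FiniteField.pow_card_sub_one_eq_one x hx
    rw [inv_pow, eq_comm, ← mul_eq_one_iff_eq_inv₀ (pow_ne_zero _ hx), ← pow_add,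
      Nat.sub_add_cancel hk.le, h]

/-- The analogue in `F` of the Jacobi sum of the characters `x ↦ x⁻¹` and `x ↦ x ^ (-j)`. -/
theorem sum_inv_mul_inv_pow {j : ℕ} (hj0 : j ≠ 0) (hj : j + 1 < Fintype.card F - 1) :
    ∑ x : F, x⁻¹ * (1 - x)⁻¹ ^ j = -((j + 1 : ℕ) : F) := by
  obtain ⟨q, hq⟩ : ∃ q, q = Fintype.card F := ⟨_, rfl⟩
  obtain ⟨i, hi⟩ : ∃ i, i = q - 1 - j := ⟨_, rfl⟩
  rw [← hq] at hj
  have h1 (x : F) : x⁻¹ * (1 - x)⁻¹ ^ j =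
      ∑ m ∈ range (i + 1), ((-1) ^ m * (i.choose m : F)) * x ^ (q - 2 + m) := by
    have h2 : x⁻¹ = x ^ (q - 2) := by
      have := inv_pow_eq_pow (F := F) (k := 1) (by omega) one_ne_zero x
      rw [← hq] at this
      rw [pow_one] at this; rw [this]; congr 1
    rw [inv_pow_eq_pow (by omega) hj0, ← hq, ← hi, h2, sub_eq_neg_add, add_pow, mul_sum]
    refine sum_congr rfl fun m _ => ?_
    rw [neg_pow, one_pow, pow_add]; ring
  rw [sum_congr rfl fun x _ => h1 x, sum_comm]
  simp only [← mul_sum]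
  -- The exponents q-2+m lie strictly between 0 and 2(q-1), so q-1 divides only the one with m = 1.
  -- Its contribution is i = q-1-j, which is -(j+1) in `F`.
  have h3 (m : ℕ) (hm : m ∈ range (i + 1)) : ((-1) ^ m * (i.choose m : F)) *
      ∑ x : F, x ^ (q - 2 + m) = if m = 1 then (i : F) else 0 := by
    rw [mem_range] at hm
    rw [sum_pow_eq (by omega), ← hq]
    split_ifs with hd hm1 hm1
    · subst hm1; simp
    · exfalso
      obtain ⟨c, hc⟩ := hd
      have : c = 0 ∨ c = 1 ∨ 2 ≤ c := by omega
      rcases this with rfl | rfl | hc2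
      · omega
      · omega
      · have := Nat.mul_le_mul_left (q - 1) hc2
        omega
    · exact absurd (by rw [hm1]; exact ⟨1, by omega⟩) hd
    · simp
  rw [sum_congr rfl h3, sum_ite_eq' , if_pos (by rw [mem_range]; omega), hi, Nat.sub_sub,
    Nat.cast_sub (by omega), hq, FiniteField.cast_card_eq_zero, zero_sub, add_comm 1 j]

variable {p : ℕ} [Fact p.Prime] {a : ℕ} [Algebra (ZMod p) F]

/-- The trace is the sum of the x^(p^k), and among the exponents q-2+p^k with k < a only k = 0 gives
a multiple of q-1. -/
theorem sum_inv_mul_trace (hF : Fintype.card F = p ^ a) (h2 : 2 < Fintype.card F) :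
    ∑ x : F, x⁻¹ * algebraMap (ZMod p) F (Algebra.trace (ZMod p) F x) = -1 := by
  have hp := (Fact.out : p.Prime).one_lt
  have ha : Module.finrank (ZMod p) F = a := by
    have := Module.card_eq_pow_finrank (K := ZMod p) (V := F)
    rw [hF, ZMod.card] at this
    exact (Nat.pow_right_injective hp this).symm
  have ha0 : 0 < a := by
    rcases Nat.eq_zero_or_pos a with rfl | h
    · rw [hF] at h2; simp at h2
    · exact h
  have h1 (x : F) : x⁻¹ * algebraMap (ZMod p) F (Algebra.trace (ZMod p) F x) =
      ∑ k ∈ range a, x ^ (p ^ a - 2 + p ^ k) := by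
    rw [FiniteField.algebraMap_trace_eq_sum_pow, ha, Nat.card_zmod, mul_sum]
    refine sum_congr rfl fun k _ => ?_
    have := inv_pow_eq_pow (F := F) (k := 1) (by omega) one_ne_zero x
    rw [pow_one, hF] at this
    rw [this, pow_add]; congr 1
  rw [sum_congr rfl fun x _ => h1 x, sum_comm]
  rw [hF] at h2
  have h3 (k : ℕ) (hk : k ∈ range a) : ∑ x : F, x ^ (p ^ a - 2 + p ^ k) =
      if k = 0 then -1 else 0 := by
    rw [mem_range] at hk
    rw [sum_pow_eq (by omega), hF]
    refine if_congr ⟨fun ⟨c, hc⟩ => ?_, fun h => ⟨1, by rw [h]; simp; omega⟩⟩ rfl rfl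
    by_contra hk0
    have h4 : p ^ k < p ^ a := Nat.pow_lt_pow_right hp hk
    have h5 : 1 < p ^ k := Nat.one_lt_pow hk0 hp
    have : c = 0 ∨ c = 1 ∨ 2 ≤ c := by omega
    rcases this with rfl | rfl | hc2
    · omega
    · omega
    · have := Nat.mul_le_mul_left (p ^ a - 1) hc2
      omega
  rw [sum_congr rfl h3, sum_ite_eq', if_pos (mem_range.mpr ha0)]

end FiniteFieldSums

/-! ### Gauss sums, Stickelberger's congruence, expansion of the additive character -/

section GaussSums

variable {K : Type*} [NormedField K] {F : Type*} [Field F]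

/-- The multiplicative character `t ↦ ω(t)⁻¹`. -/
def invChar (ω : F →*₀ K) : MulChar F K where
  toFun t := ω t⁻¹
  map_one' := by simp
  map_mul' x y := by simp [mul_comm]
  map_nonunit' x hx := by
    rw [isUnit_iff_ne_zero, not_not] at hx
    simp [hx]

/-- The additive character `t ↦ ζ ^ Tr t`. -/
noncomputable def traceChar (p : ℕ) [Fact p.Prime] [Algebra (ZMod p) F] {ζ : K} (hζ : ζ ^ p = 1) :
    AddChar F K :=
  (AddChar.zmodChar p hζ).compAddMonoidHom (Algebra.trace (ZMod p) F).toAddMonoidHom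

variable {ω : F →*₀ K}

theorem invChar_apply (t : F) : invChar ω t = ω t⁻¹ := rfl

theorem invChar_pow_apply {k : ℕ} (hk : k ≠ 0) (t : F) : (invChar ω ^ k) t = ω (t⁻¹ ^ k) := by
  rw [MulChar.pow_apply' _ hk, invChar_apply, map_pow]

theorem lead_prime_pow [IsUltrametricDist K] {p : ℕ} {π : K} (h : IsResidueLift ω π) (hπ : π ^ (p - 1) = -(p : K)) (k : ℕ) :
    Lead ω π (k * (p - 1)) ((p : K) ^ k) ((-1 : F) ^ k) := by
  refine ⟨(-1) ^ k, ?_, ((Red.one ω π).neg h).pow h k⟩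
  rw [mul_comm k, pow_mul, hπ, ← mul_pow]; simp

variable {p : ℕ} [Fact p.Prime] [Algebra (ZMod p) F] {π ζ : K}

theorem traceChar_apply (hζ : ζ ^ p = 1) (t : F) : traceChar p hζ t = Psi p ζ t := rfl

variable [Fintype F] {a : ℕ}

theorem traceChar_frobenius (hζ : ζ ^ p = 1) (t : F) :
    traceChar p hζ (t ^ p) = traceChar p hζ t := by
  have h : Algebra.trace (ZMod p) F (t ^ p) = Algebra.trace (ZMod p) F t := by
    have := Algebra.trace_eq_of_algEquiv
      (FiniteField.frobeniusAlgEquivOfAlgebraic (ZMod p) F) t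
    rwa [FiniteField.coe_frobeniusAlgEquivOfAlgebraic, ZMod.card] at this
  rw [traceChar_apply, traceChar_apply, Psi, Psi, h]

theorem traceChar_ne_one (hζ : ζ ^ p = 1) (hζ1 : ζ ≠ 1) : traceChar (F := F) p hζ ≠ 1 := by
  obtain ⟨t, ht⟩ := Algebra.trace_surjective (ZMod p) F 1
  have : Fact (1 < p) := ⟨(Fact.out : p.Prime).one_lt⟩
  intro h
  apply hζ1
  have h1 : traceChar p hζ t = 1 := by rw [h]; rfl
  rwa [traceChar_apply, Psi, ht, ZMod.val_one, pow_one] at h1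

/-- Substitute t ↦ t^p, which permutes `F` and preserves the trace. -/
theorem gaussSum_frobenius (hζ : ζ ^ p = 1) (j : ℕ) :
    gaussSum (invChar ω ^ (p * j)) (traceChar (F := F) p hζ) =
      gaussSum (invChar ω ^ j) (traceChar p hζ) := by
  have : CharP F p := charP_of_injective_algebraMap (algebraMap (ZMod p) F).injective p
  symm
  rw [gaussSum, gaussSum, ← (frobeniusEquiv F p).toEquiv.sum_comp]
  refine sum_congr rfl fun t _ => ?_
  simp only [RingEquiv.toEquiv_eq_coe, EquivLike.coe_coe, frobeniusEquiv_apply, frobenius_def]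
  rw [traceChar_frobenius, map_pow, pow_mul' (invChar ω),
    MulChar.pow_apply' _ (Fact.out : p.Prime).ne_zero]

variable [IsUltrametricDist K]

omit [Fintype F] in
theorem IsResidueLift.injective (h : IsResidueLift ω π) : Function.Injective ω :=
  fun x y hxy => (hxy ▸ Red.map ω π x).eq h (Red.map ω π y)

theorem invChar_pow_ne_one (h : IsResidueLift ω π) {j : ℕ} (hj0 : j ≠ 0)
    (hj : j < Fintype.card F - 1) : invChar ω ^ j ≠ 1 := by
  intro hc
  have h1 : ∀ x : Fˣ, x ^ j = 1 := by
    intro x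
    have h2 : (invChar ω ^ j) ((x⁻¹ : Fˣ) : F) = 1 := by rw [hc, MulChar.one_apply_coe]
    rw [invChar_pow_apply hj0, Units.val_inv_eq_inv_val, inv_inv, ← map_one ω] at h2
    exact Units.ext (by simpa using h.injective h2)
  exact absurd (Nat.le_of_dvd (by omega) ((FiniteField.forall_pow_eq_one_iff F j).mp h1))
    (by omega)

theorem Red.jacobiSum (h : IsResidueLift ω π) {j : ℕ} (hj0 : j ≠ 0)
    (hj : j + 1 < Fintype.card F - 1) :
    Red ω π (jacobiSum (invChar ω ^ j) (invChar ω)) (-((j + 1 : ℕ) : F)) := by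
  rw [← sum_inv_mul_inv_pow hj0 hj, jacobiSum_comm]
  refine Red.sum h _ fun x _ => ?_
  rw [invChar_pow_apply hj0, invChar_apply]
  exact (Red.map _ _ _).mul h (Red.map _ _ _)

-- This is ζ^k ≡ 1 + kπ modulo π², written with an explicit quotient.
omit [Fintype F] in
theorem exists_pow_eq_one_add (h : IsResidueLift ω π) (hζπ : CongrMod π 2 ζ (1 + π)) (k : ℕ) :
    ∃ y, ζ ^ k = 1 + π * y ∧ Red ω π y (k : F) := by
  obtain ⟨z, hz, hz'⟩ := hζπ
  have h1 : ζ = 1 + π * (1 + π * z) := by linear_combination hz'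
  have hr (y : K) (hy : ‖y‖ ≤ 1) : Red ω π (π * y) 0 := by
    refine Red.of_norm_le ?_
    rw [norm_mul]; exact mul_le_of_le_one_right (norm_nonneg _) hy
  have hy : Red ω π (1 + π * z) 1 := by simpa using (Red.one ω π).add h (hr z hz)
  induction k with
  | zero => exact ⟨0, by simp, by simpa using Red.zero ω π⟩
  | succ k ih =>
    obtain ⟨y, hy1, hy2⟩ := ih
    refine ⟨y + (1 + π * z) + π * (y * (1 + π * z)), ?_, ?_⟩
    · rw [pow_succ, hy1, h1]; ring
    · have := (hy2.add h hy).add h (hr _ ((hy2.mul h hy).norm_le_one h))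
      simpa using this

omit [Fintype F] in
theorem ne_one_of_congrMod (h : IsResidueLift ω π) (hζπ : CongrMod π 2 ζ (1 + π)) : ζ ≠ 1 := by
  rintro rfl
  obtain ⟨y, hy, hy'⟩ := exists_pow_eq_one_add h hζπ 1
  rw [one_pow, eq_comm, add_eq_left, mul_eq_zero, or_iff_right h.ne_zero] at hy
  rw [hy, Nat.cast_one] at hy'
  exact zero_ne_one ((Red.zero ω π).eq h hy')

theorem lead_gaussSum_one (h : IsResidueLift ω π) (hF : Fintype.card F = p ^ a)
    (h2 : 2 < Fintype.card F) (hζ : ζ ^ p = 1) (hζπ : CongrMod π 2 ζ (1 + π)) :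
    Lead ω π 1 (gaussSum (invChar ω) (traceChar (F := F) p hζ)) (-1) := by
  choose y hy hy' using exists_pow_eq_one_add (F := F) h hζπ
  refine ⟨∑ t : F, ω t⁻¹ * y (Algebra.trace (ZMod p) F t).val, ?_, ?_⟩
  · have h0 : ∑ t : F, ω t⁻¹ = 0 := by
      have hne : invChar ω ≠ 1 := by
        simpa using invChar_pow_ne_one h one_ne_zero (by omega)
      exact MulChar.sum_eq_zero_of_ne_one hne
    -- The vanishing sum absorbs the 1 in ζ^Tr = 1 + πy, which leaves a factor π. The character is
    -- nontrivial because q > 2.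
    rw [gaussSum, ← zero_add (π ^ 1 * _), ← h0, mul_sum, ← sum_add_distrib]
    refine sum_congr rfl fun t _ => ?_
    rw [traceChar_apply, Psi, hy, invChar_apply]; ring
  · rw [← sum_inv_mul_trace hF h2]
    refine Red.sum h _ fun t _ => (Red.map _ _ _).mul h ?_
    have := hy' (Algebra.trace (ZMod p) F t).val
    rwa [← map_natCast (algebraMap (ZMod p) F), ZMod.natCast_zmod_val] at this

/-- **Stickelberger's congruence** for Gauss sums. -/
theorem lead_gaussSum (h : IsResidueLift ω π) (hF : Fintype.card F = p ^ a)
    (hζ : ζ ^ p = 1) (hζπ : CongrMod π 2 ζ (1 + π)) (j : ℕ) (hj : j < p ^ a - 1) :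
    Lead ω π (digitSum p a j) (gaussSum (invChar ω ^ j) (traceChar (F := F) p hζ))
      (-digitCoeff F p a j) := by
  have : CharP F p := charP_of_injective_algebraMap (algebraMap (ZMod p) F).injective p
  have hp := (Fact.out : p.Prime).one_lt
  have ha : a ≠ 0 := by rintro rfl; simp at hj
  induction j using Nat.strong_induction_on with
  | _ j ih =>
  rcases Nat.eq_zero_or_pos j with rfl | hj0
  · rw [digitSum_zero, digitCoeff_zero, pow_zero,
      gaussSum_one_left (traceChar_ne_one hζ (ne_one_of_congrMod h hζπ))]
    exact ((Red.one ω π).neg h).lead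
  -- If p divides j, Frobenius removes the factor p and neither digit invariant changes. Otherwise a
  -- Jacobi sum links j to j - 1.
  by_cases hpj : p ∣ j
  · obtain ⟨i, rfl⟩ := hpj
    have hi : i < p * i := by
      have : 0 < i := Nat.pos_of_mul_pos_left hj0
      nlinarith
    rw [digitSum_mul (by omega), digitCoeff_mul (by omega), gaussSum_frobenius]
    exact ih i hi (by omega)
  obtain ⟨i, rfl⟩ := Nat.exists_eq_add_of_le' hj0
  have h2 : 2 < Fintype.card F := by omega
  have h1 := lead_gaussSum_one h hF h2 hζ hζπ
  rw [digitSum_succ ha hpj, digitCoeff_succ ha hpj]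
  rcases Nat.eq_zero_or_pos i with rfl | hi0
  · simpa [digitSum_zero, digitCoeff_zero] using h1
  have hJ := Red.jacobiSum (ω := ω) h hi0.ne' (by omega)
  have hcast : ((i + 1 : ℕ) : F) ≠ 0 := by
    rwa [Ne, CharP.cast_eq_zero_iff F p]
  have hJ0 : jacobiSum (invChar ω ^ i) (invChar ω) ≠ 0 := by
    intro h0
    have := hJ.norm_eq_one h (neg_ne_zero.mpr hcast)
    rw [h0, norm_zero] at this
    exact zero_ne_one this
  -- With g_j the Gauss sum of ω^(-j): g_{i+1} = g_i g_1 / J, where J is a unit with residue -(i+1).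
  -- Thus the order grows by 1 and the leading coefficient is divided by i+1.
  have hmul := jacobiSum_mul_nontrivial (χ := invChar ω ^ i) (φ := invChar ω)
    (by rw [← pow_succ]; exact invChar_pow_ne_one h (Nat.succ_ne_zero i) (by omega))
    (traceChar p hζ)
  rw [← pow_succ] at hmul
  rw [eq_div_of_mul_eq hJ0 hmul, div_eq_mul_inv]
  have := ((ih i (by omega) (by omega)).mul h h1).mul h (hJ.inv h (neg_ne_zero.mpr hcast)).lead
  convert this using 1
  rw [inv_neg]; ring

/-- The coefficients of the expansion of the additive character `Ψ` of `F` in powers of `ω`,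
see `psi_eq_sum`. -/
noncomputable def psiCoeff (ω : F →*₀ K) (ψ : AddChar F K) (j : ℕ) : K :=
  if j = 0 then 1
  else if j = Fintype.card F - 1 then -(Fintype.card F : K) / ((Fintype.card F : K) - 1)
  else gaussSum (invChar ω ^ j) ψ / ((Fintype.card F : K) - 1)

theorem Red.natCast_card_sub_one (h : IsResidueLift ω π) :
    Red ω π ((Fintype.card F : K) - 1) (-1 : F) := by
  simpa [FiniteField.cast_card_eq_zero] using
    (Red.natCast (ω := ω) h (Fintype.card F)).sub h (Red.one ω π)

/-- Dividing a Gauss sum by q-1, which has residue -1, removes the sign in Stickelberger's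
congruence. The top coefficient -q/(q-1) fits the pattern too: q = (-1)^a π^(a(p-1)), and (-1)^a is
the digit coefficient of q-1 by Wilson's theorem. -/
theorem lead_psiCoeff (h : IsResidueLift ω π) (hF : Fintype.card F = p ^ a)
    (hπ : π ^ (p - 1) = -(p : K)) (hζ : ζ ^ p = 1) (hζπ : CongrMod π 2 ζ (1 + π)) {j : ℕ}
    (hj : j < p ^ a) :
    Lead ω π (digitSum p a j) (psiCoeff ω (traceChar (F := F) p hζ) j) (digitCoeff F p a j) := by
  have : CharP F p := charP_of_injective_algebraMap (algebraMap (ZMod p) F).injective p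
  have hq := ((Red.natCast_card_sub_one (F := F) h).inv h (by simp)).lead
  rw [psiCoeff]
  split_ifs with h0 h1
  · rw [h0, digitSum_zero, digitCoeff_zero]
    exact (Red.one ω π).lead
  · rw [h1, hF, digitSum_pow_sub_one, digitCoeff_pow_sub_one, neg_div, div_eq_mul_inv,
      ← neg_mul, Nat.cast_pow]
    have := ((lead_prime_pow (F := F) h hπ a).mul h ((Red.one ω π).neg h).lead).mul h hq
    convert this using 1
    · rfl
    · rw [hF]; push_cast; ring
    · rw [inv_neg]; simp
  · have := (lead_gaussSum (a := a) h hF hζ hζπ j (by omega)).mul h hq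
    rw [div_eq_mul_inv]
    convert this using 1
    · rfl
    · rw [inv_neg]; simp

theorem sum_map_pow_range [DecidableEq F] (h : IsResidueLift ω π) {r : F} (hr : r ≠ 0) :
    ∑ j ∈ range (Fintype.card F - 1), ω r ^ j =
      if r = 1 then (Fintype.card F : K) - 1 else 0 := by
  split_ifs with hr1
  · rw [hr1]; simp [Nat.cast_sub Fintype.card_pos]
  · have hne : ω r - 1 ≠ 0 := by
      rw [sub_ne_zero, ← map_one ω]
      exact fun hc => hr1 (h.injective hc)
    apply mul_right_cancel₀ hne
    rw [geom_sum_mul, ← map_pow, FiniteField.pow_card_sub_one_eq_one r hr]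
    simp

/-- Fourier inversion on the unit group. Its constant term -1/(q-1) is split as 1 - q/(q-1), and the
second part is attached to ω(t)^(q-1); this makes the formula hold at t = 0 as well. -/
theorem psi_eq_sum (h : IsResidueLift ω π) {ψ : AddChar F K} (hψ : ψ ≠ 1) (t : F) :
    ψ t = ∑ j ∈ range (Fintype.card F), psiCoeff ω ψ j * ω t ^ j := by
  classical
  have hcard : 1 < Fintype.card F := Fintype.one_lt_card
  by_cases ht : t = 0
  · rw [ht, sum_eq_single_of_mem 0 (mem_range.mpr (by omega))
      (fun j _ hj => by rw [map_zero, zero_pow hj, mul_zero])]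
    simp [psiCoeff]
  have hq : ((Fintype.card F : K) - 1) ≠ 0 := by
    have := (Red.natCast_card_sub_one (F := F) h).norm_eq_one h (by simp)
    intro h0
    rw [h0, norm_zero] at this
    exact zero_ne_one this
  have hone : ω t ^ (Fintype.card F - 1) = 1 := by
    rw [← map_pow, FiniteField.pow_card_sub_one_eq_one t ht, map_one]
  have hG : ∑ j ∈ range (Fintype.card F - 1), gaussSum (invChar ω ^ j) ψ * ω t ^ j =
      ψ t * ((Fintype.card F : K) - 1) := by
    have h1 (j : ℕ) : gaussSum (invChar ω ^ j) ψ * ω t ^ j =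
        ∑ s : F, if s = 0 then 0 else ω (s⁻¹ * t) ^ j * ψ s := by
      rw [gaussSum, sum_mul]
      refine sum_congr rfl fun s _ => ?_
      split_ifs with hs
      · rw [hs, MulChar.map_zero]; simp
      · have : (invChar ω ^ j) s = ω s⁻¹ ^ j :=
          MulChar.pow_apply_coe (invChar ω) j (Units.mk0 s hs)
        rw [this, map_mul, mul_pow]; ring
    rw [sum_congr rfl fun j _ => h1 j, sum_comm, sum_eq_single_of_mem t (mem_univ t)]
    · simp only [if_neg ht, ← sum_mul]
      rw [sum_map_pow_range h (by simp [ht]), if_pos (by field_simp), mul_comm]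
    · intro s _ hst
      by_cases hs : s = 0
      · simp [hs]
      simp only [if_neg hs, ← sum_mul]
      rw [sum_map_pow_range h (by simp [ht, hs]), if_neg, zero_mul]
      intro hc
      rw [inv_mul_eq_one₀ hs] at hc
      exact hst hc
  obtain ⟨m, hm⟩ := Nat.exists_eq_add_of_lt hcard
  have hm' : Fintype.card F - 1 = m + 1 := by omega
  rw [hm', sum_range_succ', pow_zero, gaussSum_one_left hψ] at hG
  rw [show Fintype.card F = m + 1 + 1 by omega, sum_range_succ, sum_range_succ',
    ← hm', hone]
  have h2 (j : ℕ) (hj : j ∈ range m) : psiCoeff ω ψ (j + 1) * ω t ^ (j + 1) =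
      gaussSum (invChar ω ^ (j + 1)) ψ * ω t ^ (j + 1) / ((Fintype.card F : K) - 1) := by
    rw [mem_range] at hj
    rw [psiCoeff, if_neg (by omega), if_neg (by omega)]; ring
  rw [sum_congr rfl h2, ← sum_div, psiCoeff, if_pos rfl, psiCoeff, if_neg (by omega), if_pos rfl]
  field_simp
  linear_combination -hG

end GaussSums

/-! ### The exponential sum as a sum over exponent vectors -/

section Expansion

variable {N n : ℕ}

theorem latticeSum_apply (A : Fin N → Fin n → ℤ) (u : Fin N → ℕ) (i : Fin n) :
    latticeSum A u i = ∑ j, (u j : ℤ) * A j i := by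
  simp [latticeSum]

/-- The number of nonzero affine coordinates of `b`. -/
def affineRank (m : ℕ) (b : Fin n → ℤ) : ℕ := #{j : Fin n | m ≤ (j : ℕ) ∧ b j ≠ 0}

theorem affineRank_add_card (m : ℕ) (hmn : m ≤ n) (b : Fin n → ℤ) :
    affineRank m b + #{j : Fin n | m ≤ (j : ℕ) ∧ b j = 0} = n - m := by
  have h1 : #{j : Fin n | m ≤ (j : ℕ)} = n - m := by
    have := Fin.card_filter_val_lt (n := n) (m := m)
    have h2 := card_filter_add_card_filter_not (s := (univ : Finset (Fin n)))
      (fun j : Fin n => (j : ℕ) < m)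
    simp only [not_lt, card_univ, Fintype.card_fin] at h2
    omega
  rw [← h1, ← card_filter_add_card_filter_not (s := {j : Fin n | m ≤ (j : ℕ)})
    (fun j => b j ≠ 0), filter_filter, filter_filter, affineRank]
  simp only [not_not]

variable {K : Type*} [NormedField K] {F : Type*} [Field F] {ω : F →*₀ K}

/-- At x = 0 exponents of opposite signs could cancel in the sum but not in the product. This is why
affine coordinates must be non-negative. -/
theorem prod_zpow_mul_eq_zpow_sum {ι : Type*} (s : Finset ι) (x : K) (k : ι → ℤ)
    (h : x ≠ 0 ∨ ∀ j ∈ s, 0 ≤ k j) : ∏ j ∈ s, x ^ k j = x ^ ∑ j ∈ s, k j := by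
  classical
  induction s using Finset.induction_on with
  | empty => simp
  | insert i s hi ih =>
    rw [prod_insert hi, sum_insert hi, ih (h.imp_right fun h j hj => h j (mem_insert_of_mem hj))]
    rcases h with h | h
    · rw [zpow_add₀ h]
    · by_cases hx : x = 0
      · have h1 := h i (mem_insert_self _ _)
        have h2 := sum_nonneg fun j hj => h j (mem_insert_of_mem hj)
        obtain h1 | h1 := h1.eq_or_lt
        · rw [← h1]; simp
        · rw [hx, zero_zpow _ h1.ne', zero_zpow _ (add_pos_of_pos_of_nonneg h1 h2).ne',
            zero_mul]
      · rw [zpow_add₀ hx]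

variable [Fintype F] [IsUltrametricDist K] {π : K}

theorem sum_ne_zero_map_zpow [DecidableEq F] (h : IsResidueLift ω π) (k : ℤ) :
    ∑ x : F with x ≠ 0, ω x ^ k =
      if ((Fintype.card F : ℤ) - 1) ∣ k then (Fintype.card F : K) - 1 else 0 := by
  classical
  obtain ⟨f, hf⟩ : ∃ f : Fˣ →* K, ∀ x, f x = ω x ^ k :=
    ⟨{ toFun := fun x => ω x ^ k, map_one' := by simp,
       map_mul' := fun x y => by simp [mul_zpow] }, fun _ => rfl⟩
  have h1 : ∑ x : F with x ≠ 0, ω x ^ k = ∑ x : Fˣ, f x := by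
    symm
    refine sum_bij (fun x _ => (x : F)) (fun x _ => by simp) (fun x _ y _ h => Units.ext h)
      (fun y hy => ⟨Units.mk0 y (by simpa using hy), mem_univ _, rfl⟩) fun x _ => hf x
  have h2 : f = 1 ↔ ((Fintype.card F : ℤ) - 1) ∣ k := by
    have h3 : ((Fintype.card F : ℤ) - 1) = ((Fintype.card F - 1 : ℕ) : ℤ) := by
      rw [Nat.cast_sub Fintype.card_pos]; simp
    rw [h3, Int.natCast_dvd, ← FiniteField.forall_pow_eq_one_iff F, DFunLike.ext_iff]
    refine forall_congr' fun x => ?_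
    rw [hf, MonoidHom.one_apply, ← map_zpow₀, ← map_one ω, h.injective.eq_iff,
      pow_natAbs_eq_one, ← Units.val_zpow_eq_zpow_val, Units.val_eq_one]
  rw [h1, sum_hom_units, Fintype.card_units]
  simp only [h2]
  split_ifs
  · rw [Nat.cast_sub Fintype.card_pos, Nat.cast_one]
  · simp

/-- Unlike in the toric sum, the point x = 0 adds 0^k, which is 1 for k = 0 only. This difference
between q and q-1 is the origin of the strata. -/
theorem sum_map_zpow (h : IsResidueLift ω π) (k : ℤ) :
    ∑ x : F, ω x ^ k = if ((Fintype.card F : ℤ) - 1) ∣ k then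
      (if k = 0 then (Fintype.card F : K) else (Fintype.card F : K) - 1) else 0 := by
  classical
  have h0 : univ.filter (fun x : F => ¬ x ≠ 0) = {0} := by ext; simp
  rw [← sum_filter_add_sum_filter_not univ (fun x : F => x ≠ 0), sum_ne_zero_map_zpow h, h0,
    sum_singleton, map_zero, zero_zpow_eq]
  split_ifs <;> simp_all

theorem prod_sum_map_zpow [DecidableEq F] (h : IsResidueLift ω π) {m : ℕ} (hmn : m ≤ n)
    (b e : Fin n → ℤ) (he : ∀ j : Fin n, m ≤ (j : ℕ) → e j = 0) :
    ∏ i : Fin n, ∑ x ∈ (if (i : ℕ) < m then univ.filter (fun x : F => x ≠ 0) else univ),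
        ω x ^ (b i - e i) =
      if ∀ j, ((Fintype.card F : ℤ) - 1) ∣ b j - e j then
        ((Fintype.card F : K) - 1) ^ (m + affineRank m b) *
          (Fintype.card F : K) ^ (n - m - affineRank m b) else 0 := by
  have h1 (i : Fin n) : ∑ x ∈ (if (i : ℕ) < m then univ.filter (fun x : F => x ≠ 0) else univ),
        ω x ^ (b i - e i) = if ((Fintype.card F : ℤ) - 1) ∣ b i - e i then
          (if m ≤ (i : ℕ) ∧ b i = 0 then (Fintype.card F : K) else (Fintype.card F : K) - 1)
          else 0 := by
    split_ifs with h1 h2 h3 h4 h5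
    · omega
    · rw [sum_ne_zero_map_zpow h, if_pos h2]
    · rw [sum_ne_zero_map_zpow h, if_neg h2]
    · rw [sum_map_zpow h, if_pos h4, he i h5.1, h5.2, sub_zero, if_pos rfl]
    · rw [sum_map_zpow h, if_pos h4, he i (not_lt.mp h1), sub_zero,
        if_neg fun hc => h5 ⟨not_lt.mp h1, hc⟩]
    · rw [sum_map_zpow h, if_neg h4]
  rw [prod_congr rfl fun i _ => h1 i]
  split_ifs with hd
  · rw [prod_congr rfl fun i _ => if_pos (hd i), prod_ite, prod_const, prod_const, mul_comm]
    have h2 := affineRank_add_card m hmn b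
    have h3 := card_filter_add_card_filter_not (s := (univ : Finset (Fin n)))
      (fun j : Fin n => m ≤ (j : ℕ) ∧ b j = 0)
    rw [card_univ, Fintype.card_fin] at h3
    congr 2 <;> omega
  · push Not at hd
    obtain ⟨i, hi⟩ := hd
    exact prod_eq_zero (mem_univ i) (if_neg hi)

open Classical in
/-- The vectors `u` with `0 ≤ u_i ≤ p ^ a - 1` and `∑ i, u i • a_i ∈ M`. -/
noncomputable def admissible (p a : ℕ) (A : Fin N → Fin n → ℤ) (e : Fin n → ℤ) :
    Finset (Fin N → ℕ) :=
  {u ∈ Fintype.piFinset fun _ => range (p ^ a) | latticeSum A u ∈ Mset p a e}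

variable {p : ℕ} [Fact p.Prime] [Algebra (ZMod p) F] {a : ℕ} {ζ : K}

/-- Ψ turns the sum of monomials into a product; each factor is expanded in powers of `ω` and the
product is multiplied out. -/
theorem psi_fEval_eq_sum (h : IsResidueLift ω π) (hζ : ζ ^ p = 1) (hζ1 : ζ ≠ 1)
    (A : Fin N → Fin n → ℤ) (lam : Fin N → F) (x : Fin n → F)
    (hx : ∀ i, x i ≠ 0 ∨ ∀ j, 0 ≤ A j i) :
    Psi p ζ (fEval A lam x) = ∑ u ∈ Fintype.piFinset fun _ : Fin N => range (Fintype.card F),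
      (∏ j, psiCoeff ω (traceChar p hζ) (u j) * ω (lam j) ^ u j) *
        ∏ i, ω (x i) ^ latticeSum A u i := by
  have h1 : Psi p ζ (fEval A lam x) =
      ∏ j, traceChar p hζ (lam j * ∏ i, x i ^ A j i) := by
    rw [← traceChar_apply hζ, fEval]
    exact map_sum (traceChar p hζ).toAddMonoidHom _ _
  rw [h1, prod_congr rfl fun j _ => psi_eq_sum h (traceChar_ne_one hζ hζ1) _, prod_univ_sum]
  refine sum_congr rfl fun u _ => ?_
  have h2 (j : Fin N) : psiCoeff ω (traceChar p hζ) (u j) * ω (lam j * ∏ i, x i ^ A j i) ^ u j =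
      (psiCoeff ω (traceChar p hζ) (u j) * ω (lam j) ^ u j) *
        ∏ i, ω (x i) ^ ((u j : ℤ) * A j i) := by
    rw [map_mul, mul_pow, map_prod, ← prod_pow, mul_assoc]
    congr 2
    refine prod_congr rfl fun i _ => ?_
    rw [map_zpow₀, mul_comm, zpow_mul, zpow_natCast]
  rw [prod_congr rfl fun j _ => h2 j, prod_mul_distrib, prod_comm]
  congr 1
  refine prod_congr rfl fun i _ => ?_
  rw [latticeSum_apply]
  refine prod_zpow_mul_eq_zpow_sum _ _ _ ?_
  refine (hx i).imp (fun h => by simpa using h) fun h j _ => mul_nonneg (by positivity) (h j)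

theorem saff_eq_sum (h : IsResidueLift ω π) (hF : Fintype.card F = p ^ a)
    (hζ : ζ ^ p = 1) (hζ1 : ζ ≠ 1) {m : ℕ} (hmn : m ≤ n) (A : Fin N → Fin n → ℤ)
    (hA : ∀ i, ∀ j : Fin n, m ≤ (j : ℕ) → 0 ≤ A i j)
    (e : Fin n → ℤ) (he : ∀ j : Fin n, m ≤ (j : ℕ) → e j = 0) (lam : Fin N → F) :
    Saff p m ζ ω A e lam = ∑ u ∈ admissible p a A e,
      (∏ j, psiCoeff ω (traceChar p hζ) (u j) * ω (lam j) ^ u j) *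
        (((Fintype.card F : K) - 1) ^ (m + affineRank m (latticeSum A u)) *
          (Fintype.card F : K) ^ (n - m - affineRank m (latticeSum A u))) := by
  classical
  obtain ⟨T, hT⟩ : ∃ T : Fin n → Finset F,
    T = fun i : Fin n => if (i : ℕ) < m then univ.filter (fun x : F => x ≠ 0) else univ := ⟨_, rfl⟩
  have h1 : (univ.filter fun x : Fin n → F => ∀ i : Fin n, i.val < m → x i ≠ 0) =
      Fintype.piFinset T := by
    ext x
    simp only [mem_filter, mem_univ, true_and, Fintype.mem_piFinset, hT]
    refine forall_congr' fun i => ?_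
    split_ifs with hi <;> simp [hi]
  have h2 (x : Fin n → F) (hx : x ∈ Fintype.piFinset T) (i : Fin n) (hi : i.val < m) :
      x i ≠ 0 := by
    rw [← h1, mem_filter] at hx
    exact hx.2 i hi
  have h3 (x : Fin n → F) (hx : x ∈ Fintype.piFinset T) :
      (∏ i : Fin n with i.val < m, ω (x i) ^ (-e i)) * Psi p ζ (fEval A lam x) =
      ∑ u ∈ Fintype.piFinset fun _ : Fin N => range (p ^ a),
      (∏ j, psiCoeff ω (traceChar p hζ) (u j) * ω (lam j) ^ u j) *
        ∏ i, ω (x i) ^ (latticeSum A u i - e i) := by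
    rw [psi_fEval_eq_sum h hζ hζ1 A lam x fun i => ?_, mul_sum, hF]
    · refine sum_congr rfl fun u _ => ?_
      rw [mul_left_comm, prod_filter, ← prod_mul_distrib]
      congr 1
      refine prod_congr rfl fun i _ => ?_
      split_ifs with hi
      · rw [← zpow_add₀ (by simpa using h2 x hx i hi), neg_add_eq_sub]
      · rw [he i (not_lt.mp hi), sub_zero, one_mul]
    · rcases lt_or_ge i.val m with hi | hi
      · exact Or.inl (h2 x hx i hi)
      · exact Or.inr fun j => hA j i hi
  rw [Saff]
  calc _ = ∑ x ∈ Fintype.piFinset T,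
        (∏ i : Fin n with i.val < m, ω (x i) ^ (-e i)) * Psi p ζ (fEval A lam x) := by
        rw [← h1]
    _ = _ := by
        rw [sum_congr rfl h3, sum_comm, admissible, sum_filter]
        refine sum_congr rfl fun u _ => ?_
        rw [← mul_sum, ← prod_univ_sum T fun i x => ω x ^ (latticeSum A u i - e i), hT,
          prod_sum_map_zpow h hmn _ e he]
        have h5 : (latticeSum A u ∈ Mset p a e) ↔
            ∀ j, ((Fintype.card F : ℤ) - 1) ∣ latticeSum A u j - e j := by
          rw [hF, Nat.cast_pow]; rfl
        simp only [h5]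
        split_ifs <;> simp

theorem lead_saff_term (h : IsResidueLift ω π) (hF : Fintype.card F = p ^ a)
    (hπ : π ^ (p - 1) = -(p : K)) (hζ : ζ ^ p = 1) (hζπ : CongrMod π 2 ζ (1 + π))
    {u : Fin N → ℕ} (hu : ∀ j, u j < p ^ a) (lam : Fin N → F) (r s : ℕ) :
    Lead ω π (pWeight p a u + a * s * (p - 1))
      ((∏ j, psiCoeff ω (traceChar p hζ) (u j) * ω (lam j) ^ u j) *
        (((Fintype.card F : K) - 1) ^ r * (Fintype.card F : K) ^ s))
      ((-1) ^ (r + a * s) * ∏ j, digitCoeff F p a (u j) * lam j ^ u j) := by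
  have h1 := Lead.prod h univ fun j _ => (lead_psiCoeff h hF hπ hζ hζπ (hu j)).mul h
    ((Red.map ω π (lam j)).pow h (u j)).lead
  have h2 := ((Red.natCast_card_sub_one (F := F) h).pow h r).lead
  have h3 := lead_prime_pow (F := F) h hπ (a * s)
  convert h1.mul h (h2.mul h h3) using 1
  · simp [pWeight, digitSum]
  · rw [hF, Nat.cast_pow, pow_mul]
  · rw [pow_add]; ring

end Expansion

/-! ### Digit vectors and cyclic carrying -/

section Digits

variable {N : ℕ}

/-- The vector of the `k`-th base `p` digits of the coordinates of `u`. -/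
def digitVec (p : ℕ) (u : Fin N → ℕ) (k : ℕ) : Fin N → ℕ := fun i => u i / p ^ k % p

/-- The vector with digits `U k`. -/
def ofDigitVecs {a : ℕ} (p : ℕ) (U : Fin a → Fin N → ℕ) : Fin N → ℕ :=
  fun i => ∑ k : Fin a, p ^ (k : ℕ) * U k i

theorem sum_pow_mul_lt {p a : ℕ} (v : Fin a → ℕ) (hv : ∀ k, v k < p) :
    ∑ k : Fin a, p ^ (k : ℕ) * v k < p ^ a := by
  have := (finFunctionFinEquiv fun k => (⟨v k, hv k⟩ : Fin p)).2
  rw [finFunctionFinEquiv_apply] at this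
  simpa [mul_comm] using this

theorem sum_pow_mul_div_mod {p a : ℕ} (v : Fin a → ℕ) (hv : ∀ k, v k < p) (k : Fin a) :
    (∑ k : Fin a, p ^ (k : ℕ) * v k) / p ^ (k : ℕ) % p = v k := by
  have h1 := congrFun (finFunctionFinEquiv.symm_apply_apply
    fun k => (⟨v k, hv k⟩ : Fin p)) k
  have h2 := congrArg Fin.val h1
  rw [finFunctionFinEquiv_symm_apply_val, finFunctionFinEquiv_apply] at h2
  simpa [mul_comm] using h2

theorem sum_pow_mul_digit {p a x : ℕ} (hx : x < p ^ a) :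
    ∑ k : Fin a, p ^ (k : ℕ) * (x / p ^ (k : ℕ) % p) = x := by
  have h1 := congrArg Fin.val (finFunctionFinEquiv.apply_symm_apply (⟨x, hx⟩ : Fin (p ^ a)))
  rw [finFunctionFinEquiv_apply] at h1
  simpa [mul_comm] using h1

theorem digitVec_ofDigitVecs {p a : ℕ} {U : Fin a → Fin N → ℕ} (hU : ∀ k i, U k i < p)
    (k : Fin a) : digitVec p (ofDigitVecs p U) k = U k := by
  funext i
  exact sum_pow_mul_div_mod (fun k => U k i) (fun k => hU k i) k

theorem ofDigitVecs_lt {p a : ℕ} {U : Fin a → Fin N → ℕ} (hU : ∀ k i, U k i < p) (i : Fin N) :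
    ofDigitVecs p U i < p ^ a :=
  sum_pow_mul_lt (fun k => U k i) fun k => hU k i

theorem ofDigitVecs_digitVec {p a : ℕ} {u : Fin N → ℕ} (hu : ∀ i, u i < p ^ a) :
    ofDigitVecs p (fun k : Fin a => digitVec p u k) = u := by
  funext i
  exact sum_pow_mul_digit (hu i)

theorem pWeight_eq_sum_digitVec (p a : ℕ) (u : Fin N → ℕ) :
    pWeight p a u = ∑ k : Fin a, ∑ i, digitVec p u k i := by
  rw [pWeight, sum_comm, Fin.sum_univ_eq_sum_range fun k => ∑ i, digitVec p u k i]
  rfl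

theorem prod_digitCoeff (F : Type*) [Field F] (p a : ℕ) (u : Fin N → ℕ) :
    ∏ i, digitCoeff F p a (u i) =
      ∏ k : Fin a, ∏ i, ((Nat.factorial (digitVec p u k i) : ℕ) : F)⁻¹ := by
  rw [prod_comm]
  refine prod_congr rfl fun i _ => ?_
  exact (Fin.prod_univ_eq_prod_range
    (fun k => ((Nat.factorial (digitVec p u k i) : ℕ) : F)⁻¹) a).symm

theorem latticeSum_ofDigitVecs {n p a : ℕ} (A : Fin N → Fin n → ℤ) (U : Fin a → Fin N → ℕ) :
    latticeSum A (ofDigitVecs p U) = ∑ k : Fin a, (p : ℤ) ^ (k : ℕ) • latticeSum A (U k) := by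
  funext j
  simp only [latticeSum_apply, ofDigitVecs, Finset.sum_apply, Pi.smul_apply, smul_eq_mul, mul_sum]
  rw [sum_comm]
  refine sum_congr rfl fun i _ => ?_
  push_cast
  rw [sum_mul]
  exact sum_congr rfl fun k _ => by ring

/-- Carrying: a combination of powers of `p` is congruent modulo `p ^ a - 1` to a number at most
`p ^ a - 1` whose digit sum is at most the sum of the coefficients. -/
theorem exists_digitSum_le {p a : ℕ} (hp : 1 < p) (v : Fin a → ℕ) :
    ∃ x < p ^ a, ((p : ℤ) ^ a - 1) ∣ (∑ k : Fin a, p ^ (k : ℕ) * v k : ℕ) - x ∧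
      (x = 0 ↔ ∑ k : Fin a, p ^ (k : ℕ) * v k = 0) ∧ digitSum p a x ≤ ∑ k, v k ∧
      ((∃ k, p ≤ v k) → digitSum p a x < ∑ k, v k) := by
  obtain ⟨s, hs⟩ : ∃ s, s = ∑ k, v k := ⟨_, rfl⟩
  induction s using Nat.strong_induction_on generalizing v with
  | _ s ih =>
  by_cases hv : ∀ k, v k < p
  · refine ⟨_, sum_pow_mul_lt v hv, by simp, Iff.rfl, le_of_eq ?_, ?_⟩
    · rw [digitSum, ← Fin.sum_univ_eq_sum_range
        fun j => (∑ k : Fin a, p ^ (k : ℕ) * v k) / p ^ j % p]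
      exact sum_congr rfl fun k _ => sum_pow_mul_div_mod v hv k
    · rintro ⟨k, hk⟩
      exact absurd (hv k) (not_lt.mpr hk)
  push Not at hv
  obtain ⟨k, hk⟩ := hv
  have : NeZero a := ⟨by rintro rfl; exact k.elim0⟩
  obtain ⟨w, hw⟩ : ∃ w : Fin a → ℕ, v = w + Pi.single k p := by
    refine ⟨v - Pi.single k p, funext fun i => ?_⟩
    by_cases hi : i = k
    · subst hi; simp [hk]
    · simp [hi]
  -- A carry trades p units at position k for one at k+1, where addition in `Fin a` wraps a-1 around
  -- to 0. The coefficient sum drops by p-1, so the induction applies and the inequality becomes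
  -- strict.
  obtain ⟨v', hv'⟩ : ∃ v' : Fin a → ℕ, v' = w + Pi.single (k + 1) 1 := ⟨_, rfl⟩
  have hsum (f : Fin a → ℕ) (i : Fin a) (c : ℕ) :
      ∑ j, f j * (w + Pi.single i c : Fin a → ℕ) j = ∑ j, f j * w j + f i * c := by
    simp [mul_add, sum_add_distrib, Pi.single_apply]
  have h1 : ∑ j, v j = ∑ j, w j + p := by simpa [hw] using hsum 1 k p
  have h2 : ∑ j, v' j = ∑ j, w j + 1 := by simpa [hv'] using hsum 1 (k + 1) 1
  have h3 := hsum (fun j => p ^ (j : ℕ)) k p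
  have h4 := hsum (fun j => p ^ (j : ℕ)) (k + 1) 1
  rw [← hw] at h3
  rw [← hv'] at h4
  obtain ⟨x, hx, hx1, hx2, hx3, -⟩ := ih _ (by omega) v' rfl
  have h5 : 0 < ∑ k : Fin a, p ^ (k : ℕ) * v k := by
    rw [h3]; positivity
  have h6 : 0 < ∑ k : Fin a, p ^ (k : ℕ) * v' k := by
    rw [h4]; positivity
  -- An ordinary carry keeps the value; the wrapped one replaces p^a by 1.
  have h7 : ((p : ℤ) ^ a - 1) ∣ (p : ℤ) ^ (k : ℕ) * p - (p : ℤ) ^ ((k + 1 : Fin a) : ℕ) := by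
    rcases Nat.lt_or_ge (k + 1) a with hlt | hge
    · rw [Fin.val_add_one_of_lt' hlt, pow_succ, sub_self]
      exact dvd_zero _
    · have hka : (k : ℕ) + 1 = a := le_antisymm k.2 hge
      have : (k + 1 : Fin a) = 0 := by
        apply Fin.ext
        rw [Fin.val_add, Fin.val_one', Nat.add_mod_mod, hka, Nat.mod_self]; rfl
      rw [this, Fin.val_zero, pow_zero, ← pow_succ, hka]
  refine ⟨x, hx, ?_, ?_, by omega, fun _ => by omega⟩
  · obtain ⟨c, hc⟩ := hx1
    obtain ⟨d, hd⟩ := h7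
    refine ⟨c + d, ?_⟩
    rw [h4, Nat.cast_add, Nat.cast_mul, Nat.cast_pow, Nat.cast_one] at hc
    rw [h3, Nat.cast_add, Nat.cast_mul, Nat.cast_pow]
    linear_combination hc + hd
  · rw [hx2]; omega

end Digits

/-! ### Minimal vectors in a stratum -/

section Strata

variable {N n : ℕ} {p a m l : ℕ} {A : Fin N → Fin n → ℤ} {e : Fin n → ℤ}

theorem pWeightSet_le {M : Set (Fin n → ℤ)} {u : Fin N → ℕ} (hu : u ∈ UM p a A M) :
    pWeightSet p a A M ≤ pWeight p a u := iInf₂_le u hu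

theorem exists_pWeight_eq {M : Set (Fin n → ℤ)} (h : (UM p a A M).Nonempty) :
    ∃ u ∈ UM p a A M, pWeightSet p a A M = pWeight p a u := by
  obtain ⟨u, hu, hmin⟩ := (measure (pWeight p a)).wf.has_min _ h
  refine ⟨u, hu, le_antisymm (pWeightSet_le hu) (le_iInf₂ fun v hv => ?_)⟩
  exact_mod_cast not_lt.mp (hmin v hv)

theorem exists_pWeight_eq_of_ne_top {M : Set (Fin n → ℤ)} (h : pWeightSet p a A M ≠ ⊤) :
    ∃ u ∈ UM p a A M, pWeightSet p a A M = pWeight p a u := by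
  refine exists_pWeight_eq (Set.nonempty_iff_ne_empty.mpr fun hem => h ?_)
  simp [pWeightSet, hem]

/-- Non-negative terms cannot cancel, so the vanishing of an affine coordinate depends only on the
support of u. Carrying preserves this support, hence the stratum. -/
theorem latticeSum_eq_zero_iff {j : Fin n} (hA : ∀ i, 0 ≤ A i j) (u : Fin N → ℕ) :
    latticeSum A u j = 0 ↔ ∀ i, u i = 0 ∨ A i j = 0 := by
  rw [latticeSum_apply, sum_eq_zero_iff_of_nonneg fun i _ => mul_nonneg (by positivity) (hA i)]
  simp

theorem latticeSum_mem_Mset_iff {u v : Fin N → ℕ}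
    (huv : ∀ i, ((p : ℤ) ^ a - 1) ∣ (u i : ℤ) - v i) :
    latticeSum A u ∈ Mset p a e ↔ latticeSum A v ∈ Mset p a e := by
  refine forall_congr' fun j => ?_
  refine dvd_iff_dvd_of_dvd_sub ?_
  rw [sub_sub_sub_cancel_right, latticeSum_apply, latticeSum_apply, ← sum_sub_distrib]
  refine dvd_sum fun i _ => ?_
  rw [← sub_mul]
  exact Dvd.dvd.mul_right (huv i) _

theorem latticeSum_mem_Mstratum_iff (hA : ∀ i, ∀ j : Fin n, m ≤ (j : ℕ) → 0 ≤ A i j)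
    {u v : Fin N → ℕ} (huv : ∀ i, ((p : ℤ) ^ a - 1) ∣ (u i : ℤ) - v i)
    (h0 : ∀ i, u i = 0 ↔ v i = 0) :
    latticeSum A u ∈ Mstratum p a m e l ↔ latticeSum A v ∈ Mstratum p a m e l := by
  refine and_congr (latticeSum_mem_Mset_iff huv) ?_
  have h : ∀ j : Fin n, (m ≤ (j : ℕ) ∧ latticeSum A u j ≠ 0) ↔
      (m ≤ (j : ℕ) ∧ latticeSum A v j ≠ 0) := by
    intro j
    refine and_congr_right fun hj => not_congr ?_
    rw [latticeSum_eq_zero_iff fun i => hA i j hj, latticeSum_eq_zero_iff fun i => hA i j hj]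
    simp only [h0]
  simp only [h]

/-- A vector all of whose digit vectors are allowed to be large can be replaced by an element
of `U_{M_l}` of no larger `p`-weight. -/
theorem exists_pWeight_le (hp : 1 < p) (hA : ∀ i, ∀ j : Fin n, m ≤ (j : ℕ) → 0 ≤ A i j)
    (U : Fin a → Fin N → ℕ) (hU : latticeSum A (ofDigitVecs p U) ∈ Mstratum p a m e l) :
    ∃ u ∈ UM p a A (Mstratum p a m e l), pWeight p a u ≤ ∑ k, ∑ i, U k i ∧
      ((∃ k i, p ≤ U k i) → pWeight p a u < ∑ k, ∑ i, U k i) := by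
  choose u hu hu1 hu2 hu3 hu4 using fun i => exists_digitSum_le hp fun k => U k i
  refine ⟨u, ⟨fun i => Nat.le_sub_one_of_lt (hu i), ?_⟩, ?_, ?_⟩
  · refine (latticeSum_mem_Mstratum_iff hA (fun i => ?_) fun i => ?_).mp hU
    · exact hu1 i
    · exact (hu2 i).symm
  · rw [sum_comm]
    exact sum_le_sum fun i _ => hu3 i
  · rintro ⟨k, i, hki⟩
    rw [sum_comm]
    exact sum_lt_sum (fun i _ => hu3 i) ⟨i, mem_univ i, hu4 i ⟨k, hki⟩⟩

/-- Exchange argument: put v in place of the k-th digit vector. The lattice point stays the same,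
and carrying yields a competitor in the same stratum, whose weight cannot be below that of u. The
strict part yields goodness. -/
theorem minimal_digitVec (hp : 1 < p) (hA : ∀ i, ∀ j : Fin n, m ≤ (j : ℕ) → 0 ≤ A i j)
    {u : Fin N → ℕ} (hu : u ∈ UM p a A (Mstratum p a m e l))
    (hmin : pWeightSet p a A (Mstratum p a m e l) = pWeight p a u) (k : Fin a)
    {v : Fin N → ℕ} (hv : v ∈ Uplus A (latticeSum A (digitVec p u k))) :
    ∑ i, digitVec p u k i ≤ ∑ i, v i ∧
      ((∃ i, p ≤ v i) → ∑ i, digitVec p u k i < ∑ i, v i) := by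
  classical
  have hlt (i : Fin N) : u i < p ^ a := by
    have := hu.1 i
    have : 0 < p ^ a := pow_pos (by omega) a
    omega
  obtain ⟨U, hU⟩ : ∃ U : Fin a → Fin N → ℕ,
    U = Function.update (fun k : Fin a => digitVec p u k) k v := ⟨_, rfl⟩
  have h1 : latticeSum A (ofDigitVecs p U) = latticeSum A u := by
    conv_rhs => rw [← ofDigitVecs_digitVec hlt]
    rw [latticeSum_ofDigitVecs, latticeSum_ofDigitVecs]
    refine sum_congr rfl fun k' _ => ?_
    congr 1
    by_cases hk : k' = k
    · subst hk; rw [hU, Function.update_self]; exact hv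
    · rw [hU, Function.update_of_ne hk]
  obtain ⟨u', hu', h2, h3⟩ := exists_pWeight_le hp hA U (h1 ▸ hu.2)
  have h4 : pWeight p a u ≤ pWeight p a u' := by
    have := pWeightSet_le hu'
    rw [hmin] at this
    exact_mod_cast this
  have h5 : ∑ k, ∑ i, U k i + ∑ i, digitVec p u k i = pWeight p a u + ∑ i, v i := by
    rw [pWeight_eq_sum_digitVec, ← add_sum_erase _ _ (mem_univ k),
      ← add_sum_erase univ (fun k : Fin a => ∑ i, digitVec p u k i) (mem_univ k)]
    have : ∑ x ∈ univ.erase k, ∑ i, U x i = ∑ x ∈ univ.erase k, ∑ i, digitVec p u x i :=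
      sum_congr rfl fun x hx => by rw [hU, Function.update_of_ne (ne_of_mem_erase hx)]
    rw [this, hU, Function.update_self]
    ring
  refine ⟨by omega, fun ⟨i, hi⟩ => ?_⟩
  have := h3 ⟨k, i, by rw [hU, Function.update_self]; exact hi⟩
  omega

theorem weight_digitVec (hp : 1 < p) (hA : ∀ i, ∀ j : Fin n, m ≤ (j : ℕ) → 0 ≤ A i j)
    {u : Fin N → ℕ} (hu : u ∈ UM p a A (Mstratum p a m e l))
    (hmin : pWeightSet p a A (Mstratum p a m e l) = pWeight p a u) (k : Fin a) :
    weight A (latticeSum A (digitVec p u k)) = (∑ i, digitVec p u k i : ℕ) :=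
  le_antisymm (iInf₂_le_of_le (digitVec p u k) rfl le_rfl) <| le_iInf₂ fun v hv => by
    exact_mod_cast (minimal_digitVec hp hA hu hmin k hv).1

theorem digitVec_mem_uplusMin (hp : 1 < p) (hA : ∀ i, ∀ j : Fin n, m ≤ (j : ℕ) → 0 ≤ A i j)
    {u : Fin N → ℕ} (hu : u ∈ UM p a A (Mstratum p a m e l))
    (hmin : pWeightSet p a A (Mstratum p a m e l) = pWeight p a u) (k : Fin a) :
    digitVec p u k ∈ UplusMin A (latticeSum A (digitVec p u k)) :=
  ⟨rfl, (weight_digitVec hp hA hu hmin k).symm⟩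

theorem isGood_digitVec (hp : 1 < p) (hA : ∀ i, ∀ j : Fin n, m ≤ (j : ℕ) → 0 ≤ A i j)
    {u : Fin N → ℕ} (hu : u ∈ UM p a A (Mstratum p a m e l))
    (hmin : pWeightSet p a A (Mstratum p a m e l) = pWeight p a u) (k : Fin a) :
    IsGood p A (latticeSum A (digitVec p u k)) := by
  intro v hv i
  by_contra! hi
  have h1 := (minimal_digitVec hp hA hu hmin k hv.1).2 ⟨i, by omega⟩
  have h2 := hv.2
  rw [weight_digitVec hp hA hu hmin k] at h2
  have h3 : ∑ i, v i = ∑ i, digitVec p u k i := by exact_mod_cast h2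
  omega

theorem digitVec_mem_gammaSet (hp : 1 < p) (hA : ∀ i, ∀ j : Fin n, m ≤ (j : ℕ) → 0 ≤ A i j)
    {u : Fin N → ℕ} (hu : u ∈ UM p a A (Mstratum p a m e l))
    (hmin : pWeightSet p a A (Mstratum p a m e l) = pWeight p a u) :
    (fun k : Fin a => latticeSum A (digitVec p u k)) ∈
      GammaSet p a A (Mstratum p a m e l) := by
  refine ⟨isGood_digitVec hp hA hu hmin, ?_, ?_⟩
  · have hlt (i : Fin N) : u i < p ^ a := by
      have := hu.1 i
      have : 0 < p ^ a := pow_pos (by omega) a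
      omega
    rw [← latticeSum_ofDigitVecs, ofDigitVecs_digitVec hlt]
    exact hu.2
  · rw [hmin, pWeight_eq_sum_digitVec, Nat.cast_sum]
    exact sum_congr rfl fun k _ => (weight_digitVec hp hA hu hmin k).symm

/-- Goodness bounds the entries by p-1, so the chosen representations are genuine digits and no
carry occurs. -/
theorem ofDigitVecs_mem_of_gammaSet {M : Set (Fin n → ℤ)} (hp : 1 < p) {γ : Fin a → Fin n → ℤ}
    (hγ : γ ∈ GammaSet p a A M) {U : Fin a → Fin N → ℕ} (hU : ∀ k, U k ∈ UplusMin A (γ k)) :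
    (∀ k i, U k i < p) ∧ ofDigitVecs p U ∈ UM p a A M ∧
      pWeightSet p a A M = pWeight p a (ofDigitVecs p U) := by
  have h1 (k : Fin a) (i : Fin N) : U k i < p := by
    have := hγ.1 k (U k) (hU k) i
    omega
  refine ⟨h1, ⟨fun i => Nat.le_sub_one_of_lt (ofDigitVecs_lt h1 i), ?_⟩, ?_⟩
  · rw [latticeSum_ofDigitVecs]
    convert hγ.2.1 using 3 with k
    exact (hU k).1
  · rw [hγ.2.2, pWeight_eq_sum_digitVec, Nat.cast_sum]
    refine sum_congr rfl fun k _ => ?_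
    rw [digitVec_ofDigitVecs h1, (hU k).2]

/-- Passing to the open stratum: every vanishing affine coordinate is made nonzero by changing
a zero coordinate of `u` to `p ^ a - 1`. -/
theorem exists_mem_open_stratum [Fact p.Prime] (hmn : m ≤ n)
    (hA : ∀ i, ∀ j : Fin n, m ≤ (j : ℕ) → 0 ≤ A i j)
    (hA' : ∀ j : Fin n, m ≤ (j : ℕ) → ∃ i, A i j ≠ 0) (ha : a ≠ 0)
    {u : Fin N → ℕ} (hu : u ∈ UM p a A (Mset p a e)) :
    ∃ v ∈ UM p a A (Mstratum p a m e (n - m)),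
      pWeight p a v ≤ pWeight p a u + a * (n - m - affineRank m (latticeSum A u)) * (p - 1) := by
  classical
  have hp := (Fact.out : p.Prime).one_lt
  choose f hf using hA'
  obtain ⟨Z, hZ⟩ : ∃ Z : Finset (Fin n),
    Z = univ.filter fun j : Fin n => m ≤ (j : ℕ) ∧ latticeSum A u j = 0 := ⟨_, rfl⟩
  have hZm (j : Z) : m ≤ (j : Fin n).val ∧ latticeSum A u j = 0 := by
    obtain ⟨j, hj⟩ := j
    rw [hZ, mem_filter] at hj
    exact hj.2
  obtain ⟨I, hI⟩ : ∃ I : Finset (Fin N), I = Z.attach.image fun j : Z => f j (hZm j).1 := ⟨_, rfl⟩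
  obtain ⟨v, hv⟩ : ∃ v : Fin N → ℕ,
    v = fun i => if i ∈ I then p ^ a - 1 else u i := ⟨_, rfl⟩
  have hq : 1 < p ^ a := Nat.one_lt_pow ha hp
  have hu0 (i : Fin N) (hi : i ∈ I) : u i = 0 := by
    rw [hI] at hi
    obtain ⟨j, -, rfl⟩ := mem_image.mp hi
    exact ((latticeSum_eq_zero_iff (fun i => hA i j (hZm j).1) u).mp (hZm j).2 _).resolve_right
      (hf j (hZm j).1)
  -- Replacing 0 by q-1 does not change the class modulo q-1.
  have hmem : latticeSum A v ∈ Mset p a e := by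
    refine (latticeSum_mem_Mset_iff fun i => ?_).mpr hu.2
    by_cases hi : i ∈ I
    · rw [hv]
      simp only [if_pos hi, hu0 i hi]
      rw [Nat.cast_sub hq.le]
      simp
    · rw [hv]; simp [if_neg hi]
  have hrank : affineRank m (latticeSum A v) = n - m := by
    rw [← affineRank_add_card m hmn (latticeSum A v), eq_comm, Nat.add_eq_left, card_eq_zero,
      filter_eq_empty_iff]
    rintro j - ⟨hj, hj0⟩
    rw [latticeSum_eq_zero_iff fun i => hA i j hj] at hj0
    have hjZ : j ∉ Z := by
      intro hjZ
      have := (hj0 (f j hj)).resolve_right (hf j hj)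
      rw [hv] at this
      simp only [if_pos (hI ▸ mem_image_of_mem (fun j : Z => f j (hZm j).1)
        (mem_attach Z ⟨j, hjZ⟩) : f j hj ∈ I)] at this
      omega
    apply hjZ
    rw [hZ, mem_filter]
    refine ⟨mem_univ j, hj, (latticeSum_eq_zero_iff (fun i => hA i j hj) u).mpr fun i => ?_⟩
    by_cases hi : i ∈ I
    · exact Or.inl (hu0 i hi)
    · refine (hj0 i).imp_left fun h => ?_
      rw [hv] at h
      simpa only [if_neg hi] using h
  refine ⟨v, ⟨fun i => ?_, hmem, hrank⟩, ?_⟩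
  · rw [hv]
    dsimp only
    split_ifs
    exacts [le_rfl, hu.1 i]
  · have h1 (i : Fin N) : digitSum p a (v i) ≤
        digitSum p a (u i) + if i ∈ I then a * (p - 1) else 0 := by
      rw [hv]
      dsimp only
      split_ifs
      · rw [digitSum_pow_sub_one]; omega
      · rfl
    have h2 := affineRank_add_card m hmn (latticeSum A u)
    have h3 : #Z = n - m - affineRank m (latticeSum A u) := by rw [hZ]; omega
    refine (sum_le_sum fun i _ => h1 i).trans ?_
    rw [sum_add_distrib, sum_ite_mem, univ_inter, sum_const, smul_eq_mul, ← h3]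
    refine Nat.add_le_add_left ?_ _
    -- One index may serve several vanishing coordinates, hence only an inequality.
    have h4 : #I ≤ #Z := by
      rw [hI, ← card_attach (s := Z)]
      exact card_image_le
    calc _ ≤ #Z * (a * (p - 1)) := Nat.mul_le_mul_right _ h4
      _ = _ := by ring

end Strata

/-! ### The Hasse polynomial as a sum of leading monomials -/

section HassePolynomial

variable {N n : ℕ} {p a m : ℕ} [Fact p.Prime] {A : Fin N → Fin n → ℤ} {e : Fin n → ℤ}

/-- The monomial that `u` contributes to the Hasse polynomial, up to sign. -/
noncomputable def digitMonomial (p a : ℕ) [Fact p.Prime] (u : Fin N → ℕ) :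
    MvPolynomial (Fin N) (ZMod p) :=
  C (∏ i, digitCoeff (ZMod p) p a (u i)) * ∏ i, X i ^ u i

/-- Substituting λ^(p^k) in the k-th factor multiplies its exponents by p^k, so the exponents add up
to u through its base-p expansion. -/
theorem digitMonomial_ofDigitVecs {U : Fin a → Fin N → ℕ} (hU : ∀ k i, U k i < p) :
    digitMonomial p a (ofDigitVecs p U) = ∏ k : Fin a, expand (p ^ (k : ℕ))
      (C (∏ i, ((Nat.factorial (U k i) : ZMod p))⁻¹) * ∏ i, X i ^ U k i) := by
  simp only [map_mul, expand_C, map_prod, map_pow, expand_X]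
  rw [digitMonomial, prod_mul_distrib, prod_digitCoeff, map_prod]
  congr 1
  · refine prod_congr rfl fun k _ => ?_
    rw [digitVec_ofDigitVecs hU, map_prod]
  · rw [prod_comm]
    refine prod_congr rfl fun i _ => ?_
    rw [ofDigitVecs, ← prod_pow_eq_pow_sum]
    exact prod_congr rfl fun k _ => by rw [pow_mul]

open Classical in
/-- The elements of `U_{M_l}` of minimal `p`-weight. -/
noncomputable def minimalVecs (p a m : ℕ) (A : Fin N → Fin n → ℤ) (e : Fin n → ℤ) (l : ℕ) :
    Finset (Fin N → ℕ) :=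
  {u ∈ admissible p a A e | affineRank m (latticeSum A u) = l ∧
    pWeightSet p a A (Mstratum p a m e l) = pWeight p a u}

theorem mem_admissible {u : Fin N → ℕ} :
    u ∈ admissible p a A e ↔ u ∈ UM p a A (Mset p a e) := by
  have : 0 < p ^ a := pow_pos (Fact.out : p.Prime).pos a
  simp only [admissible, mem_filter, Fintype.mem_piFinset, mem_range, UM, Set.mem_ofPred_eq]
  refine and_congr_left fun _ => forall_congr' fun i => ?_
  omega

theorem mem_minimalVecs {l : ℕ} {u : Fin N → ℕ} :
    u ∈ minimalVecs p a m A e l ↔ u ∈ UM p a A (Mstratum p a m e l) ∧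
      pWeightSet p a A (Mstratum p a m e l) = pWeight p a u := by
  rw [minimalVecs, mem_filter, mem_admissible, ← and_assoc]
  refine and_congr_left fun _ => ?_
  rw [UM, UM, Set.mem_ofPred_eq, Set.mem_ofPred_eq, and_assoc]
  rfl

theorem prod_expand_Fpoly (γ : Fin a → Fin n → ℤ) :
    ∏ k : Fin a, expand (p ^ (k : ℕ)) (Fpoly p A (γ k)) =
      ∑ U ∈ Fintype.piFinset fun k => (uplusMin_finite A (γ k)).toFinset,
        ∏ k : Fin a, expand (p ^ (k : ℕ))
          (C (∏ i, ((Nat.factorial (U k i) : ZMod p))⁻¹) * ∏ i, X i ^ U k i) := by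
  rw [← prod_univ_sum (fun k => (uplusMin_finite A (γ k)).toFinset)
    fun k u => expand (p ^ (k : ℕ))
          (C (∏ i, ((Nat.factorial (u i) : ZMod p))⁻¹) * ∏ i, X i ^ u i)]
  refine prod_congr rfl fun k _ => ?_
  rw [← map_sum, Fpoly, finsum_mem_eq_finite_toFinset_sum _ (uplusMin_finite A (γ k))]

/-- Group the minimal u by the lattice points γ_k of their digit vectors. The fibre over γ is the
product of the sets of minimal representations of the γ_k. -/
theorem finsum_gammaSet_eq (hA : ∀ i, ∀ j : Fin n, m ≤ (j : ℕ) → 0 ≤ A i j) {l : ℕ}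
    (hl : pWeightSet p a A (Mstratum p a m e l) ≠ ⊤) :
    ∑ᶠ γ ∈ GammaSet p a A (Mstratum p a m e l),
      ∏ k : Fin a, expand (p ^ (k : ℕ)) (Fpoly p A (γ k)) =
    ∑ u ∈ minimalVecs p a m A e l, digitMonomial p a u := by
  classical
  have hp := (Fact.out : p.Prime).one_lt
  have hfin := gammaSet_finite p a A (Mstratum p a m e l) hl
  rw [finsum_mem_eq_finite_toFinset_sum _ hfin]
  have hmaps : ∀ u ∈ minimalVecs p a m A e l,
      (fun k : Fin a => latticeSum A (digitVec p u k)) ∈ hfin.toFinset := by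
    intro u hu
    rw [mem_minimalVecs] at hu
    exact hfin.mem_toFinset.mpr (digitVec_mem_gammaSet hp hA hu.1 hu.2)
  rw [← sum_fiberwise_of_maps_to hmaps]
  refine sum_congr rfl fun γ hγ => ?_
  rw [hfin.mem_toFinset] at hγ
  rw [prod_expand_Fpoly]
  have hmem {U : Fin a → Fin N → ℕ}
      (hU : U ∈ Fintype.piFinset fun k => (uplusMin_finite A (γ k)).toFinset) (k : Fin a) :
      U k ∈ UplusMin A (γ k) := by
    have := Fintype.mem_piFinset.mp hU k
    simpa using this
  refine sum_bij' (fun U _ => ofDigitVecs p U) (fun u _ => fun k : Fin a => digitVec p u k)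
    (fun U hU => ?_) (fun u hu => ?_) (fun U hU => ?_) (fun u hu => ?_) (fun U hU => ?_)
  · obtain ⟨h1, h2, h3⟩ := ofDigitVecs_mem_of_gammaSet hp hγ (hmem hU)
    rw [mem_filter, mem_minimalVecs]
    refine ⟨⟨h2, h3⟩, funext fun k => ?_⟩
    rw [digitVec_ofDigitVecs h1]
    exact (hmem hU k).1
  · rw [mem_filter, mem_minimalVecs] at hu
    obtain ⟨⟨h1, h2⟩, rfl⟩ := hu
    refine Fintype.mem_piFinset.mpr fun k => ?_
    rw [Set.Finite.mem_toFinset]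
    exact digitVec_mem_uplusMin hp hA h1 h2 k
  · obtain ⟨h1, -⟩ := ofDigitVecs_mem_of_gammaSet hp hγ (hmem hU)
    exact funext fun k => digitVec_ofDigitVecs h1 k
  · rw [mem_filter, mem_minimalVecs] at hu
    refine ofDigitVecs_digitVec fun i => ?_
    have := hu.1.1.1 i
    have : 0 < p ^ a := pow_pos (by omega) a
    omega
  · obtain ⟨h1, -⟩ := ofDigitVecs_mem_of_gammaSet hp hγ (hmem hU)
    exact (digitMonomial_ofDigitVecs h1).symm

/-- The order in `π` of the term of the exponential sum that belongs to `u`. -/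
def termOrder (p a m : ℕ) (A : Fin N → Fin n → ℤ) (u : Fin N → ℕ) : ℕ :=
  pWeight p a u + a * (n - m - affineRank m (latticeSum A u)) * (p - 1)

/-- The sign of the leading coefficient of the term that belongs to `u`. -/
def termSign (a m : ℕ) (A : Fin N → Fin n → ℤ) (u : Fin N → ℕ) : ℕ :=
  m + affineRank m (latticeSum A u) + a * (n - m - affineRank m (latticeSum A u))

theorem affineRank_le (hmn : m ≤ n) (b : Fin n → ℤ) : affineRank m b ≤ n - m := by
  have := affineRank_add_card m hmn b
  omega

/-- The exponent: the weight of the open stratum is the least order of a term. -/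
theorem exists_pWeightSet_open_stratum (hmn : m ≤ n)
    (hA : ∀ i, ∀ j : Fin n, m ≤ (j : ℕ) → 0 ≤ A i j)
    (hA' : ∀ j : Fin n, m ≤ (j : ℕ) → ∃ i, A i j ≠ 0) (ha : a ≠ 0)
    (hU : (UM p a A (Mset p a e)).Nonempty) :
    ∃ c : ℕ, (c : ℕ∞) = pWeightSet p a A (Mstratum p a m e (n - m)) ∧
      (∀ u ∈ admissible p a A e, c ≤ termOrder p a m A u) ∧
      ∃ u ∈ admissible p a A e, termOrder p a m A u = c := by
  obtain ⟨u0, hu0⟩ := hU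
  obtain ⟨v0, hv0, -⟩ := exists_mem_open_stratum hmn hA hA' ha hu0
  obtain ⟨v, hv, hc⟩ := exists_pWeight_eq ⟨v0, hv0⟩
  refine ⟨pWeight p a v, hc.symm, fun u hu => ?_, v, mem_admissible.mpr ⟨hv.1, hv.2.1⟩, ?_⟩
  · obtain ⟨w, hw, hwle⟩ := exists_mem_open_stratum hmn hA hA' ha (mem_admissible.mp hu)
    have h1 := pWeightSet_le hw
    rw [hc] at h1
    exact (by exact_mod_cast h1 : pWeight p a v ≤ pWeight p a w).trans hwle
  · have : affineRank m (latticeSum A v) = n - m := hv.2.2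
    simp [termOrder, this]

theorem hassePoly_eq_sum (hmn : m ≤ n) (hA : ∀ i, ∀ j : Fin n, m ≤ (j : ℕ) → 0 ≤ A i j)
    {c : ℕ} (hc : (c : ℕ∞) = pWeightSet p a A (Mstratum p a m e (n - m)))
    (hmin : ∀ u ∈ admissible p a A e, c ≤ termOrder p a m A u) :
    hassePoly p a m A e = ∑ u ∈ admissible p a A e with termOrder p a m A u = c,
      (-1) ^ termSign a m A u * digitMonomial p a u := by
  classical
  have hextr {l : ℕ} : l ∈ extremalStrata p a m A e ↔ l ≤ n - m ∧
      pWeightSet p a A (Mstratum p a m e l) + ((a * (n - m - l) * (p - 1) : ℕ) : ℕ∞) = c := by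
    rw [extremalStrata, mem_filter, mem_range, Nat.lt_succ_iff, hc]
  -- A vector of least weight in the stratum of u has order at least c and at most that of u; so if
  -- u has order c, its stratum is extremal.
  have hmaps : ∀ u ∈ {u ∈ admissible p a A e | termOrder p a m A u = c},
      affineRank m (latticeSum A u) ∈ extremalStrata p a m A e := by
    intro u hu
    rw [mem_filter] at hu
    have hu1 := mem_admissible.mp hu.1
    rw [hextr]
    refine ⟨affineRank_le hmn _, ?_⟩
    have hmem : u ∈ UM p a A (Mstratum p a m e (affineRank m (latticeSum A u))) :=
      ⟨hu1.1, hu1.2, rfl⟩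
    obtain ⟨v, hv, hveq⟩ := exists_pWeight_eq ⟨u, hmem⟩
    have h1 := hmin v (mem_admissible.mpr ⟨hv.1, hv.2.1⟩)
    have h2 := pWeightSet_le hmem
    have h3 : affineRank m (latticeSum A v) = affineRank m (latticeSum A u) := hv.2.2
    rw [hveq] at h2 ⊢
    have h4 : pWeight p a v ≤ pWeight p a u := by exact_mod_cast h2
    have h5 := hu.2
    rw [termOrder, h3] at h1
    rw [termOrder] at h5
    norm_cast
    omega
  rw [hassePoly, ← sum_fiberwise_of_maps_to hmaps]
  refine sum_congr rfl fun l hl => ?_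
  rw [hextr] at hl
  have htop : pWeightSet p a A (Mstratum p a m e l) ≠ ⊤ := by
    intro h
    have := hl.2
    rw [h, top_add] at this
    exact ENat.natCast_ne_top c this.symm
  rw [finsum_gammaSet_eq hA htop, mul_sum]
  obtain ⟨w, -, hw⟩ := exists_pWeight_eq_of_ne_top htop
  have hl2 := hl.2
  rw [hw] at hl2
  have h1 : pWeight p a w + a * (n - m - l) * (p - 1) = c := by exact_mod_cast hl2
  refine sum_congr ?_ fun u hu => ?_
  · ext u
    rw [mem_filter, mem_filter, minimalVecs, mem_filter, and_assoc]
    refine and_congr_right fun _ => ?_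
    rw [and_comm]
    refine and_congr_left fun hr => ?_
    rw [hw, termOrder, hr, ← h1, Nat.cast_inj]
    omega
  · rw [termSign, (mem_filter.mp hu).2]

theorem digitMonomial_eq_monomial (u : Fin N → ℕ) :
    digitMonomial p a u = monomial (Finsupp.equivFunOnFinite.symm u)
      (∏ i, digitCoeff (ZMod p) p a (u i)) := by
  rw [digitMonomial, monomial_eq, Finsupp.prod_fintype _ _ fun i => pow_zero _]
  rfl

theorem digitCoeff_ne_zero (j : ℕ) : digitCoeff (ZMod p) p a j ≠ 0 := by
  refine prod_ne_zero_iff.mpr fun k _ => inv_ne_zero ?_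
  rw [Ne, ZMod.natCast_eq_zero_iff, (Fact.out : p.Prime).dvd_factorial, not_le]
  exact Nat.mod_lt _ (Fact.out : p.Prime).pos

theorem coeff_sum_digitMonomial (s : Finset (Fin N → ℕ)) (σ : (Fin N → ℕ) → ℕ) (d : Fin N →₀ ℕ) :
    coeff d (∑ u ∈ s, (-1) ^ σ u * digitMonomial p a u) =
      if ⇑d ∈ s then (-1) ^ σ d * ∏ i, digitCoeff (ZMod p) p a (d i) else 0 := by
  classical
  have h (u : Fin N → ℕ) : coeff d ((-1) ^ σ u * digitMonomial p a u) =
      if u = ⇑d then (-1) ^ σ d * ∏ i, digitCoeff (ZMod p) p a (d i) else 0 := by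
    have h1 : ((-1 : MvPolynomial (Fin N) (ZMod p)) ^ σ u) = C ((-1) ^ σ u) := by simp
    rw [h1, coeff_C_mul, digitMonomial_eq_monomial, coeff_monomial]
    by_cases hu : u = d
    · rw [if_pos (Finsupp.ext fun i => congrFun hu i), if_pos hu, hu]
    · rw [if_neg fun h => hu (by rw [← h]; rfl), if_neg hu, mul_zero]
  rw [coeff_sum, sum_congr rfl fun u _ => h u, sum_ite_eq']

/-- Distinct u give distinct monomials, so nothing cancels, not even between strata; factorials of
digits are invertible modulo p. -/
theorem sum_digitMonomial_ne_zero {s : Finset (Fin N → ℕ)} (hs : s.Nonempty)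
    (σ : (Fin N → ℕ) → ℕ) : ∑ u ∈ s, (-1) ^ σ u * digitMonomial p a u ≠ 0 := by
  obtain ⟨u, hu⟩ := hs
  intro h0
  have h1 := coeff_sum_digitMonomial (p := p) (a := a) s σ (Finsupp.equivFunOnFinite.symm u)
  rw [h0, coeff_zero, if_pos (by exact hu)] at h1
  exact mul_ne_zero (pow_ne_zero _ (neg_ne_zero.mpr one_ne_zero))
    (prod_ne_zero_iff.mpr fun i _ => digitCoeff_ne_zero _) h1.symm

theorem degreeOf_sum_digitMonomial_le {s : Finset (Fin N → ℕ)} {q : ℕ}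
    (hs : ∀ u ∈ s, ∀ i, u i ≤ q) (σ : (Fin N → ℕ) → ℕ) (i : Fin N) :
    degreeOf i (∑ u ∈ s, (-1) ^ σ u * digitMonomial p a u) ≤ q := by
  rw [degreeOf_le_iff]
  intro d hd
  rw [mem_support_iff, coeff_sum_digitMonomial] at hd
  exact hs d (by by_contra h; exact hd (if_neg h)) i

theorem aeval_digitMonomial {F : Type*} [Field F] [Algebra (ZMod p) F] (u : Fin N → ℕ)
    (lam : Fin N → F) :
    aeval lam (digitMonomial p a u) = ∏ i, digitCoeff F p a (u i) * lam i ^ u i := by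
  simp [digitMonomial, prod_mul_distrib, digitCoeff]

end HassePolynomial

/-! ### Lifting the polynomial to integer coefficients -/

section Lift

variable {N p : ℕ} [Fact p.Prime]

/-- The lift of a polynomial over `𝔽_p` with coefficients in `{0, …, p - 1}`. -/
noncomputable def natLift (H : MvPolynomial (Fin N) (ZMod p)) : MvPolynomial (Fin N) ℤ_[p] :=
  ∑ d ∈ H.support, monomial d ((H.coeff d).val : ℤ_[p])

theorem coeff_natLift (H : MvPolynomial (Fin N) (ZMod p)) (d : Fin N →₀ ℕ) :
    (natLift H).coeff d = ((H.coeff d).val : ℤ_[p]) := by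
  classical
  simp only [natLift, coeff_sum, coeff_monomial, sum_ite_eq']
  split_ifs with h
  · rfl
  · rw [notMem_support_iff.mp h]; simp

theorem map_natLift (H : MvPolynomial (Fin N) (ZMod p)) : map PadicInt.toZMod (natLift H) = H := by
  ext d
  rw [coeff_map, coeff_natLift, map_natCast, ZMod.natCast_zmod_val]

theorem degreeOf_natLift_le (H : MvPolynomial (Fin N) (ZMod p)) (i : Fin N) :
    degreeOf i (natLift H) ≤ degreeOf i H := by
  rw [degreeOf_le_iff]
  intro d hd
  refine monomial_le_degreeOf i (mem_support_iff.mpr fun h => ?_)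
  rw [mem_support_iff, coeff_natLift, h] at hd
  simp at hd

theorem Red.eval_natLift {K : Type*} [NormedField K] [IsUltrametricDist K]
    [NormedAlgebra ℚ_[p] K] {F : Type*} [Field F] [Algebra (ZMod p) F] {ω : F →*₀ K} {π : K}
    (h : IsResidueLift ω π) (H : MvPolynomial (Fin N) (ZMod p)) (lam : Fin N → F) :
    Red ω π (eval₂ ((algebraMap ℚ_[p] K).comp PadicInt.Coe.ringHom) (fun j => ω (lam j))
      (natLift H)) (aeval lam H) := by
  rw [natLift, eval₂_sum, aeval_def, eval₂_eq]
  refine Red.sum h _ fun d _ => ?_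
  rw [eval₂_monomial, map_natCast, Finsupp.prod]
  refine Red.mul h ?_ (Red.prod h _ fun i _ => (Red.map _ _ _).pow h _)
  have := Red.natCast (ω := ω) h (H.coeff d).val
  rwa [← map_natCast (algebraMap (ZMod p) F), ZMod.natCast_zmod_val] at this

end Lift

/-! ### The leading term of the exponential sum -/

section ExponentialSum

variable {N n : ℕ} {p a m : ℕ} [Fact p.Prime] {A : Fin N → Fin n → ℤ} {e : Fin n → ℤ}
  {K : Type*} [NormedField K] [IsUltrametricDist K] {F : Type*} [Field F] [Fintype F]
  [Algebra (ZMod p) F] {ω : F →*₀ K} {π ζ : K}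

theorem lead_saff (h : IsResidueLift ω π) (hF : Fintype.card F = p ^ a)
    (hπ : π ^ (p - 1) = -(p : K)) (hζ : ζ ^ p = 1) (hζπ : CongrMod π 2 ζ (1 + π)) (hmn : m ≤ n)
    (hA : ∀ i, ∀ j : Fin n, m ≤ (j : ℕ) → 0 ≤ A i j)
    (he : ∀ j : Fin n, m ≤ (j : ℕ) → e j = 0)
    {c : ℕ} (hc : (c : ℕ∞) = pWeightSet p a A (Mstratum p a m e (n - m)))
    (hmin : ∀ u ∈ admissible p a A e, c ≤ termOrder p a m A u) (lam : Fin N → F) :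
    Lead ω π c (Saff p m ζ ω A e lam) (aeval lam (hassePoly p a m A e)) := by
  classical
  rw [saff_eq_sum h hF hζ (ne_one_of_congrMod h hζπ) hmn A hA e he lam,
    hassePoly_eq_sum hmn hA hc hmin, map_sum, sum_filter]
  refine Lead.sum h _ fun u hu => ?_
  have hlt (i : Fin N) : u i < p ^ a := by
    rw [admissible, mem_filter, Fintype.mem_piFinset] at hu
    exact mem_range.mp (hu.1 i)
  have h1 := lead_saff_term h hF hπ hζ hζπ hlt lam (m + affineRank m (latticeSum A u))
    (n - m - affineRank m (latticeSum A u))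
  change Lead ω π (termOrder p a m A u) _ _ at h1
  split_ifs with ho
  · rw [ho] at h1
    rw [map_mul, aeval_digitMonomial, map_pow, map_neg, map_one]
    exact h1
  · exact h1.zero_of_lt h (lt_of_le_of_ne (hmin u hu) (Ne.symm ho))

omit [IsUltrametricDist K] in
theorem neg_logb_norm_uniformizer_pow [NormedAlgebra ℚ_[p] K] (hπ : π ^ (p - 1) = -(p : K)) (c : ℕ) :
    -Real.logb p (‖π‖ ^ c) = (c : ℝ) / ((p : ℝ) - 1) := by
  have hp := (Fact.out : p.Prime).one_lt
  have hp' : (1 : ℝ) < p := by exact_mod_cast hp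
  have h1 := congrArg (Real.logb p) (norm_uniformizer_pow hπ)
  rw [Real.logb_pow, Real.logb_inv, Real.logb_self_eq_one hp', Nat.cast_sub hp.le,
    Nat.cast_one] at h1
  rw [Real.logb_pow, eq_div_iff (by linarith)]
  linear_combination (-(c : ℝ)) * h1

end ExponentialSum

end HasseAffine

theorem theorem7p9
    (p : ℕ) [Fact p.Prime] (a : ℕ)
    -- the finite field with `q = p ^ a` elements
    {F : Type*} [Field F] [Fintype F] [Algebra (ZMod p) F] (hF : Fintype.card F = p ^ a)
    -- the field `ℚ_p(ζ_p, ζ_{q-1})` with its `p`-adic absolute value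
    {K : Type*} [NormedField K] [NormedAlgebra ℚ_[p] K]
    [IsCyclotomicExtension {p, p ^ a - 1} ℚ_[p] K]
    -- the uniformizer `π`, the `p`-th root of unity that belongs to it, the Teichmüller character
    (π : K) (hπ : π ^ (p - 1) = -(p : K))
    (ζ : K) (hζ : ζ ^ p = 1) (hζπ : HasseAffine.CongrMod π 2 ζ (1 + π))
    (ω : F →*₀ K) (hω : HasseAffine.IsTeichmuller ω)
    -- `m` toric and `n - m` affine variables
    (N n m : ℕ) (hmn : m ≤ n)
    (A : Fin N → Fin n → ℤ)
    (hA : ∀ i, ∀ j : Fin n, m ≤ (j : ℕ) → 0 ≤ A i j)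
    (hA' : ∀ j : Fin n, m ≤ (j : ℕ) → ∃ i, A i j ≠ 0)
    (e : Fin n → ℤ) (he : ∀ j : Fin n, m ≤ (j : ℕ) → e j = 0)
    (hU : (HasseAffine.UM p a A (HasseAffine.Mset p a e)).Nonempty) :
    ∃ c : ℕ,
      (c : ℕ∞) = HasseAffine.pWeightSet p a A (HasseAffine.Mstratum p a m e (n - m)) ∧
      HasseAffine.IsHasseInvariant p a π ω (HasseAffine.Saff p m ζ ω A e) c
        (HasseAffine.hassePoly p a m A e) ∧
      ∀ lam : Fin N → F,
        (MvPolynomial.aeval lam (HasseAffine.hassePoly p a m A e) ≠ 0 →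
          HasseAffine.ordp p (HasseAffine.Saff p m ζ ω A e lam) =
            (((c : ℝ) / ((p : ℝ) - 1) : ℝ) : EReal)) ∧
        (MvPolynomial.aeval lam (HasseAffine.hassePoly p a m A e) = 0 →
          (((c : ℝ) / ((p : ℝ) - 1) : ℝ) : EReal) <
            HasseAffine.ordp p (HasseAffine.Saff p m ζ ω A e lam)) := by
  have hult : IsUltrametricDist K := HasseAffine.isUltrametricDist_of_normedAlgebra p
  have h : HasseAffine.IsResidueLift ω π := hω.isResidueLift hF hπ
  have hp : 1 < p := (Fact.out : p.Prime).one_lt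
  have hp' : (1 : ℝ) < p := by exact_mod_cast hp
  have ha : a ≠ 0 := by
    rintro rfl
    have := Fintype.one_lt_card (α := F)
    rw [hF, pow_zero] at this
    exact lt_irrefl _ this
  obtain ⟨c, hc, hmin, u, hu, huc⟩ :=
    HasseAffine.exists_pWeightSet_open_stratum hmn hA hA' ha hU
  have hlead := HasseAffine.lead_saff h hF hπ hζ hζπ hmn hA he hc hmin
  have hH := HasseAffine.hassePoly_eq_sum hmn hA hc hmin
  have hlogb := HasseAffine.neg_logb_norm_uniformizer_pow hπ c
  refine ⟨c, hc, ⟨HasseAffine.natLift (HasseAffine.hassePoly p a m A e), fun s => ?_, fun j => ?_,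
    HasseAffine.map_natLift _, ?_, fun lam => ?_⟩, fun lam => ⟨fun hne => ?_, fun h0 => ?_⟩⟩
  · exact ⟨((HasseAffine.hassePoly p a m A e).coeff s).val, by
      rw [HasseAffine.coeff_natLift, PadicInt.coe_natCast, Rat.cast_natCast]⟩
  · refine (HasseAffine.degreeOf_natLift_le _ j).trans ?_
    rw [hH]
    refine HasseAffine.degreeOf_sum_digitMonomial_le (fun u hu => ?_) _ j
    exact (HasseAffine.mem_admissible.mp (Finset.mem_filter.mp hu).1).1
  · rw [hH]
    exact HasseAffine.sum_digitMonomial_ne_zero ⟨u, Finset.mem_filter.mpr ⟨hu, huc⟩⟩ _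
  · obtain ⟨z, hz, hz'⟩ := hlead lam
    have hsub := hz'.norm_sub_le
      (HasseAffine.Red.eval_natLift h (HasseAffine.hassePoly p a m A e) lam)
    have hπ0 := h.ne_zero
    -- Both z = S/π^c and the value of the lifted polynomial have residue H(λ), so their difference
    -- is divisible by π.
    refine ⟨π⁻¹ * (z - MvPolynomial.eval₂ ((algebraMap ℚ_[p] K).comp PadicInt.Coe.ringHom)
      (fun j => ω (lam j)) (HasseAffine.natLift (HasseAffine.hassePoly p a m A e))), ?_, ?_⟩
    · rw [norm_mul, norm_inv, inv_mul_le_iff₀ (norm_pos_iff.mpr hπ0), mul_one]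
      exact hsub
    · rw [hz, pow_succ]
      field_simp
  · have hn := (hlead lam).norm_eq h hne
    have hS : HasseAffine.Saff p m ζ ω A e lam ≠ 0 := by
      rw [← norm_ne_zero_iff, hn]
      exact pow_ne_zero _ (norm_ne_zero_iff.mpr h.ne_zero)
    rw [HasseAffine.ordp, if_neg hS, hn, hlogb]
  · have hlt := HasseAffine.Lead.norm_lt h (h0 ▸ hlead lam)
    rw [HasseAffine.ordp]
    split_ifs with hS
    · exact EReal.coe_lt_top _
    · rw [EReal.coe_lt_coe_iff, ← hlogb, neg_lt_neg_iff]
      exact Real.logb_lt_logb hp' (norm_pos_iff.mpr hS) hlt
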